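/- Let $(A,\mathfrak m)$ be a Cohen–Macaulay local ring with $d=\dim A>0$ admitting a canonical module $\mathrm K_A$, and let $I\neq A$ be a canonical ideal, i.e. an ideal with $I\cong \mathrm K_A$ as an $A$-module. Let $Q=(a_1,\dots,a_d)$ be a parameter ideal of $A$ (generated by a system of parameters) with $a_1\in I$, put $J=I+Q$, and assume that $Q$ is a reduction of $J$, i.e. $J^{r+1}=QJ^r$ for some $r\ge 0$. Let $\mathcal T=A[Qt]$ and $\mathcal R=A[Jt]$ be the Rees algebras, let $\mathcal S_Q(J)=J\mathcal R/J\mathcal T\cong\bigoplus_{i\ge1}J^{i+1}/JQ^i$ be the Sally module, and let its rank be the length of the $\mathcal T_{\mathfrak p}$-module $\mathcal S_Q(J)_{\mathfrak p}$, where $\mathfrak p=\mathfrak m\mathcal T$. Let $n\ge 1$ and suppose that $A$ is an $n$-Goto ring with respect to $Q$, i.e. $\mathcal S_Q(J)$ is generated over $\mathcal T$ by its homogeneous elements of degree one and has rank $n$. Let $\mathrm e_0(J),\dots,\mathrm e_d(J)$ be the Hilbert coefficients of $J$, i.e. the integers with $\ell_A(A/J^{\ell+1})=\sum_{i=0}^d(-1)^i\mathrm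 e_i(J)\binom{\ell+d-i}{d-i}$ for all $\ell\gg0$, where $\ell_A(-)$ denotes length. Then all lengths $\ell_A(A/J^{\ell+1})$ are finite, and $$\ell_A(A/J^{\ell+1})=\mathrm e_0(J)\binom{\ell+d}{d}-\bigl[\mathrm e_0(J)-\ell_A(A/J)+n\bigr]\binom{\ell+d-1}{d-1}+n\binom{\ell+d-2}{d-2}$$ for all $\ell\ge0$ if $d\ge2$. If $d=1$, the same holds for all $\ell\ge 1$ with the last term omitted: $\ell_A(A/J^{\ell+1})=\mathrm e_0(J)(\ell+1)-[\mathrm e_0(J)-\ell_A(A/J)+n]$. Hence $\mathrm e_2(J)=n$ if $d\ge2$, and $\mathrm e_i(J)=0$ for all $3\le i\le d$. -/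

import Mathlib

universe u

open Polynomial Filter CategoryTheory

noncomputable section

/-! ### Cohen-Macaulay local rings and canonical ideals -/

/-- A maximal Cohen-Macaulay module over a Noetherian local ring `A`: a finitely generated module
`M` admitting an `M`-regular sequence of length `dim A` inside the maximal ideal.
(`IsRegular` contains `M ≠ (rs) M`, so `M ≠ 0`.) -/
def IsMaximalCohenMacaulay (A : Type u) [CommRing A] [IsLocalRing A]
    (M : Type u) [AddCommGroup M] [Module A M] : Prop :=
  Module.Finite A M ∧ ∃ rs : List A, (∀ r ∈ rs, r ∈ IsLocalRing.maximalIdeal A) ∧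
    RingTheory.Sequence.IsRegular M rs ∧ ringKrullDim A = (rs.length : WithBot ℕ∞)

/-- A Noetherian local ring is Cohen-Macaulay if it is maximal Cohen-Macaulay over itself. -/
def IsCohenMacaulayLocalRing (A : Type u) [CommRing A] [IsLocalRing A] : Prop :=
  IsNoetherianRing A ∧ IsMaximalCohenMacaulay A A

/-- A canonical module of a Cohen-Macaulay local ring `A` of dimension `d`, with residue field `k`:
a maximal Cohen-Macaulay module `K` of finite injective dimension and of type one, that is,
`Ext^d_A(k, K) ≅ k`. -/
def IsCanonicalModule (A : Type u) [CommRing A] [IsLocalRing A]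
    (K : Type u) [AddCommGroup K] [Module A K] : Prop :=
  IsMaximalCohenMacaulay A K ∧
  (∃ m : ℕ, HasInjectiveDimensionLE (ModuleCat.of A K) m) ∧
  ∃ d : ℕ, ringKrullDim A = d ∧
    Nonempty (Abelian.Ext (ModuleCat.of A (IsLocalRing.ResidueField A)) (ModuleCat.of A K) d
      ≃ₗ[A] IsLocalRing.ResidueField A)

/-- A canonical ideal: a proper ideal isomorphic to a canonical module. -/
def IsCanonicalIdeal {A : Type u} [CommRing A] [IsLocalRing A] (I : Ideal A) : Prop :=
  I ≠ ⊤ ∧ IsCanonicalModule A I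

/-! ### Parameter ideals and reductions -/

/-- `a₁, …, a_d` is a system of parameters of the local ring `A`: `d = dim A` and
`(a₁, …, a_d)` is primary to the maximal ideal. -/
def IsSystemOfParameters {A : Type u} [CommRing A] [IsLocalRing A] {d : ℕ} (a : Fin d → A) : Prop :=
  ringKrullDim A = d ∧
    (Ideal.span (Set.range a)).radical = IsLocalRing.maximalIdeal A

/-- `Q` is a reduction of `J`. -/
def IsReductionOf {A : Type u} [CommRing A] (Q J : Ideal A) : Prop :=
  Q ≤ J ∧ ∃ r : ℕ, J ^ (r + 1) = Q * J ^ r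

/-- The condition `(♯)` for `Q`: it is a parameter ideal `Q = (a₁, …, a_d)` with `a₁ ∈ I`, and it is
a reduction of `I + Q`. -/
def SatisfiesSharp {A : Type u} [CommRing A] [IsLocalRing A] (I Q : Ideal A) : Prop :=
  (∃ (d : ℕ) (hd : 0 < d) (a : Fin d → A), IsSystemOfParameters a ∧
      Q = Ideal.span (Set.range a) ∧ a ⟨0, hd⟩ ∈ I) ∧
  IsReductionOf Q (I ⊔ Q)

/-! ### Sally modules -/

section Sally

variable {A : Type u} [CommRing A]

/-- For ideals `J` and `Q`, with `R(Q) = A[Qt] ⊆ A[t]`: the `R(Q)`-submodule of `A[t]` generated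
by `J · R(L)`. It is used for `L = J` and for `L = Q`. -/
def mulRees (J Q L : Ideal A) : Submodule (reesAlgebra Q) A[X] :=
  Submodule.span (reesAlgebra Q) {f | ∃ a ∈ J, ∃ g ∈ reesAlgebra L, f = C a * g}

/-- The Sally module `S_Q(J) = J R(J) / J R(Q)` (for `Q ⊆ J`), a module over the Rees algebra
`R(Q)`, realized as the image of `J R(J)` in the quotient module `A[t] / J R(Q)`. -/
def sallyModule (J Q : Ideal A) : Submodule (reesAlgebra Q) (A[X] ⧸ mulRees J Q Q) :=
  (mulRees J Q J).map (mulRees J Q Q).mkQ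

/-- The homogeneous component of degree `i` of the Sally module: the classes of the homogeneous
polynomials `c t ^ i` that lie in `J R(J)`. -/
def sallyComponent (J Q : Ideal A) (i : ℕ) : Set (A[X] ⧸ mulRees J Q Q) :=
  {s | ∃ c : A, monomial i c ∈ mulRees J Q J ∧ (mulRees J Q Q).mkQ (monomial i c) = s}

/-- The Sally module is generated over `R(Q)` by its homogeneous elements of degree one. -/
def SallyGeneratedInDegreeOne (J Q : Ideal A) : Prop :=
  sallyModule J Q = Submodule.span (reesAlgebra Q) (sallyComponent J Q 1)

variable [IsLocalRing A]

open Classical in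
/-- The rank of the Sally module: the length of its localization at the prime ideal
`p = 𝔪 R(Q)` over `R(Q)_p`. (The ideal `𝔪 R(Q)` is prime for every parameter ideal `Q`; the value
`0` in the other case plays no role.) -/
def sallyRank (J Q : Ideal A) : ℕ∞ :=
  if _h : ((IsLocalRing.maximalIdeal A).map (algebraMap A (reesAlgebra Q))).IsPrime then
    Module.length
      (Localization.AtPrime ((IsLocalRing.maximalIdeal A).map (algebraMap A (reesAlgebra Q))))
      (LocalizedModule
        ((IsLocalRing.maximalIdeal A).map (algebraMap A (reesAlgebra Q))).primeCompl
        (sallyModule J Q))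
  else 0

/-- `A` is an `n`-Goto ring with respect to `Q` (for the canonical ideal `I`): with `J = I + Q`,
the Sally module of `J` with respect to `Q` is generated in degree one and has rank `n`. -/
def IsGotoWithRespectTo (n : ℕ) (I Q : Ideal A) : Prop :=
  SatisfiesSharp I Q ∧ SallyGeneratedInDegreeOne (I ⊔ Q) Q ∧ sallyRank (I ⊔ Q) Q = n

end Sally

/-! ### Hilbert functions and Hilbert coefficients -/

section Hilbert

variable {A : Type u} [CommRing A]

/-- The Hilbert function `ℓ ↦ ℓ_A(A / J^(ℓ+1))`. It is used for ideals for which these lengths are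
finite. -/
def hilbertFunction (J : Ideal A) (l : ℕ) : ℕ := (Module.length A (A ⧸ J ^ (l + 1))).toNat

/-- `e₀, …, e_d` are the Hilbert coefficients of `J` (in dimension `d`):
`ℓ_A(A / J^(ℓ+1)) = ∑_{i=0}^{d} (-1)^i e_i * binom(ℓ+d-i, d-i)` for all large `ℓ`. By convention
`e_i = 0` for `i > d`. -/
def IsHilbertCoefficients (d : ℕ) (J : Ideal A) (e : ℕ → ℤ) : Prop :=
  (∀ i, d < i → e i = 0) ∧
  ∀ᶠ l : ℕ in atTop, (hilbertFunction J l : ℤ) =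
    ∑ i ∈ Finset.range (d + 1), (-1) ^ i * e i * ((l + (d - i)).choose (d - i) : ℤ)

open Classical in
/-- The Hilbert coefficient `e_i(J)` (in dimension `d`). -/
def hilbertCoeff (d : ℕ) (J : Ideal A) (i : ℕ) : ℤ :=
  if h : ∃ e : ℕ → ℤ, IsHilbertCoefficients d J e then h.choose i else 0

theorem eq_zero_of_eventually_sum_choose_eq_zero (d : ℕ) (c : ℕ → ℤ)
    (h : ∀ᶠ l : ℕ in atTop, ∑ k ∈ Finset.range (d + 1), c k * ((l + k).choose k : ℤ) = 0) :
    ∀ k ≤ d, c k = 0 := by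
  induction d generalizing c with
  | zero =>
    obtain ⟨l, hl⟩ := h.exists
    intro k hk
    obtain rfl : k = 0 := by omega
    simpa using hl
  | succ d ih =>
    have h1 : ∀ k ≤ d, c (k + 1) = 0 := by
      apply ih (fun k => c (k + 1))
      obtain ⟨N, hN⟩ := eventually_atTop.1 h
      refine eventually_atTop.2 ⟨N + 1, fun l hl => ?_⟩
      obtain ⟨m, rfl⟩ : ∃ m, l = m + 1 := ⟨l - 1, by omega⟩
      have e1 := hN m (by omega)
      have e2 := hN (m + 1) (by omega)
      rw [Finset.sum_range_succ'] at e1 e2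
      have e3 := sub_eq_zero.2 (e2.trans e1.symm)
      simp only [Nat.choose_zero_right, add_sub_add_right_eq_sub, ← Finset.sum_sub_distrib] at e3
      rw [← e3]
      refine Finset.sum_congr rfl fun k _ => ?_
      have : (m + 1 + (k + 1)).choose (k + 1)
          = (m + 1 + k).choose k + (m + (k + 1)).choose (k + 1) := by
        rw [show m + 1 + (k + 1) = (m + 1 + k) + 1 by ring, Nat.choose_succ_succ,
          show m + (k + 1) = m + 1 + k by ring]
      rw [this]
      push_cast
      ring
    intro k hk
    rcases k with _ | k
    · obtain ⟨l, hl⟩ := h.exists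
      rw [Finset.sum_range_succ', Finset.sum_eq_zero] at hl
      · simpa using hl
      · intro k hk
        rw [h1 k (by simpa [Nat.lt_succ_iff] using hk), zero_mul]
    · exact h1 k (by omega)

/-- Hilbert coefficients are unique, so `hilbertCoeff` picks them out as soon as they exist. -/
theorem IsHilbertCoefficients.hilbertCoeff_eq {d : ℕ} {J : Ideal A} {e : ℕ → ℤ}
    (he : IsHilbertCoefficients d J e) (i : ℕ) : hilbertCoeff d J i = e i := by
  have hex : ∃ e : ℕ → ℤ, IsHilbertCoefficients d J e := ⟨e, he⟩
  rw [hilbertCoeff, dif_pos hex]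
  obtain ⟨h0, h1⟩ := hex.choose_spec
  set e' := hex.choose
  by_cases hi : d < i
  · rw [h0 i hi, he.1 i hi]
  have key := eq_zero_of_eventually_sum_choose_eq_zero d
    (fun k => (-1) ^ (d - k) * (e' (d - k) - e (d - k))) (by
      filter_upwards [h1, he.2] with l h2 h3
      rw [← Finset.sum_range_reflect, ← sub_eq_zero.2 (h2.symm.trans h3),
        ← Finset.sum_sub_distrib]
      refine Finset.sum_congr rfl fun k hk => ?_
      have hk' : k ≤ d := by simpa [Nat.lt_succ_iff] using hk
      rw [show d + 1 - 1 - k = d - k by omega, show d - (d - k) = k by omega]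
      ring) (d - i) (by omega)
  rw [show d - (d - i) = i by omega] at key
  have : e' i - e i = 0 := by
    rcases mul_eq_zero.1 key with h | h
    · exact absurd h (pow_ne_zero _ (by norm_num))
    · exact h
  linarith

end Hilbert

end

/-!
The argument rests on two facts about the ideal `I`: it is a maximal Cohen-Macaulay module, and it
contains one of the parameters generating `Q`, say `a`. Every system of parameters is regular on a maximal
Cohen-Macaulay module (`isWeaklyRegular_of_support`), hence quasi-regular on `A` and on `I`. Two
consequences for the powers of `Q`, with `d = dim A` and `h k = binom (k + d - 1) (d - 1)` the
number of monomials of degree `k` in `d` variables: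

* `Q ^ k / Q ^ (k + 1)` and `Q ^ k / Q ^ k J` are free of rank `h k` over `A / Q` and `A / J`, so
  `ℓ(A / Q ^ k J) = binom (k + d - 1) d * ℓ(A / Q) + h k * ℓ(A / J)`;
* `Q ^ k J ^ 2 / Q ^ (k + 1) J` is the sum of `h k` copies of `J ^ 2 / Q J`
  (`hasIndependentCoeffs_sq_mul`). Since `J ^ 2 ≤ I + Q J`, only forms with coefficients in `I`
  have to be considered, and `I ∩ Q ^ (k + 1) J ≤ Q ^ (k + 1) I`: with `Q₀` generated by the other
  parameters, `J Q ^ (k + 1) = I Q ^ (k + 1) + Q₀ ^ (k + 2)`, and an element `z` of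
  `I ∩ Q₀ ^ (k + 2)` satisfies `a z ∈ Q₀ ^ (k + 2) I`, whence `z ∈ Q₀ ^ (k + 2) I` because `a` is a
  nonzerodivisor modulo `Q₀ ^ (k + 2) I`.

If the Sally module is generated in degree one, then `J ^ (k + 2) = Q ^ k J ^ 2`, so its component
of degree `k + 1` is `Q ^ k J ^ 2 / Q ^ (k + 1) J`. By the second point the Sally module is filtered
by copies of `R(Q) / m R(Q)`, one for each step of a composition series of `J ^ 2 / Q J`, and its
rank is `n = ℓ(J ^ 2 / Q J)` (`sallyRank_eq_length`). Therefore
`ℓ(A / J ^ (k + 2)) = ℓ(A / Q ^ (k + 1) J) - h k * n` for all `k ≥ 0`, which is the asserted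
formula.
-/

/-! ### Systems of parameters on maximal Cohen-Macaulay modules -/

open IsLocalRing RingTheory.Sequence Module Pointwise in
/-- A module with a regular sequence of length `r` has no nonzero submodule of dimension less
than `r`. If `y` is the first term, such a submodule `N` lies in `yM` by induction; as `N = yN'`
with `N' ≅ N` of the same kind, `N` lies in `y ^ k M` for all `k`, and Krull's intersection theorem
applies. -/
theorem Submodule.eq_bot_of_supportDim_lt_length {A : Type*} [CommRing A] [IsLocalRing A]
    [IsNoetherianRing A] {M : Type*} [AddCommGroup M] [Module A M] [Module.Finite A M]
    (rs : List A) (mem : ∀ r ∈ rs, r ∈ maximalIdeal A) (reg : IsWeaklyRegular M rs)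
    (N : Submodule A M) (hN : supportDim A N < rs.length) : N = ⊥ := by
  induction rs generalizing M with
  | nil =>
    rw [← Submodule.subsingleton_iff_eq_bot]
    by_contra h
    rw [not_subsingleton_iff_nontrivial] at h
    have : Nonempty (Module.support A N) := Module.nonempty_support_of_nontrivial.to_subtype
    exact absurd hN (not_lt.2 (by simpa using! Order.krullDim_nonneg))
  | cons y ys ih =>
    rw [isWeaklyRegular_cons_iff] at reg
    obtain ⟨hy, hys⟩ := reg
    have hym : y ∈ maximalIdeal A := mem y (by simp)
    have key : ∀ N : Submodule A M, supportDim A N < (y :: ys).length →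
        N ≤ LinearMap.range (LinearMap.lsmul A M y) := by
      intro N hN
      have h1 := Module.supportDim_quotSMulTop_succ_eq_supportDim
        (IsSMulRegular.submodule N y hy) hym
      have h2 : N.map (y • (⊤ : Submodule A M)).mkQ = ⊥ := by
        refine ih (M := QuotSMulTop y M) (fun r hr => mem r (by simp [hr])) hys _ ?_
        have hle : (y • (⊤ : Submodule A N)) ≤
            LinearMap.ker ((y • (⊤ : Submodule A M)).mkQ.submoduleMap N) := by
          rintro _ ⟨n, -, rfl⟩
          rw [LinearMap.mem_ker]
          apply Subtype.ext
          exact (Submodule.Quotient.mk_eq_zero _).2 ⟨n, trivial, rfl⟩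
        have h3 : supportDim A (N.map (y • (⊤ : Submodule A M)).mkQ) ≤
            supportDim A (QuotSMulTop y N) := by
          refine supportDim_le_of_surjective (Submodule.liftQ _ _ hle) ?_
          rw [← LinearMap.range_eq_top, Submodule.range_liftQ, LinearMap.range_eq_top]
          exact LinearMap.submoduleMap_surjective _ _
        refine h3.trans_lt ?_
        rw [← h1, List.length_cons, Nat.cast_add, Nat.cast_one] at hN
        exact lt_of_add_lt_add_right hN
      rw [← LinearMap.le_ker_iff_map, Submodule.ker_mkQ] at h2
      intro n hn
      obtain ⟨m, -, hm⟩ := h2 hn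
      exact ⟨m, hm⟩
    have key2 : ∀ k : ℕ, ∀ N : Submodule A M, supportDim A N < (y :: ys).length →
        N ≤ Ideal.span {y} ^ k • (⊤ : Submodule A M) := by
      intro k
      induction k with
      | zero => intro N _; simp
      | succ k ihk =>
        intro N hN
        set N' := N.comap (LinearMap.lsmul A M y) with hN'
        have hmap : N'.map (LinearMap.lsmul A M y) = N := by
          rw [hN', Submodule.map_comap_eq, inf_eq_right]
          exact key N hN
        have e : N' ≃ₗ[A] N := (Submodule.equivMapOfInjective (LinearMap.lsmul A M y) hy N').trans
          (LinearEquiv.ofEq _ _ hmap)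
        have h3 := ihk N' ((supportDim_eq_of_equiv e).trans_lt hN)
        rw [← hmap, pow_succ', Submodule.mul_smul]
        rintro _ ⟨n, hn, rfl⟩
        exact Submodule.smul_mem_smul (Ideal.mem_span_singleton_self y) (h3 hn)
    have hK := Ideal.iInf_pow_smul_eq_bot_of_isLocalRing (M := M) (Ideal.span {y}) (by
      rw [Ne, Ideal.span_singleton_eq_top]
      exact hym)
    rw [eq_bot_iff, ← hK]
    exact le_iInf fun k => key2 k N hN

open IsLocalRing Module in
theorem supportDim_le_supportDim_quotient_add_length {A : Type*} [CommRing A] [IsLocalRing A]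
    [IsNoetherianRing A] {M : Type*} [AddCommGroup M] [Module A M] [Module.Finite A M]
    (xs : List A) (mem : ∀ r ∈ xs, r ∈ maximalIdeal A) :
    supportDim A M ≤ supportDim A (M ⧸ Ideal.ofList xs • (⊤ : Submodule A M)) + xs.length := by
  induction xs generalizing M with
  | nil =>
    rw [Ideal.ofList_nil, Submodule.bot_smul]
    simpa using (supportDim_eq_of_equiv (Submodule.quotEquivOfEqBot ⊥ rfl)).ge
  | cons x xs ih =>
    have h1 := supportDim_le_supportDim_quotSMulTop_succ (M := M) (mem x (by simp))
    have h2 := ih (M := QuotSMulTop x M) fun r hr => mem r (by simp [hr])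
    rw [supportDim_eq_of_equiv (Submodule.quotOfListConsSMulTopEquivQuotSMulTopInner M x _)]
    refine h1.trans ((add_le_add_left h2 1).trans ?_)
    simp [add_assoc]

open IsLocalRing RingTheory.Sequence Module Abelian in
/-- If `M` has a regular sequence of length `r` in the maximal ideal, and `xs` are `r` elements of
the maximal ideal such that `M / (xs)M` has no prime but the maximal ideal in its support, then
`xs` is `M`-regular. The first term `x` is a nonzerodivisor because the submodule annihilated by `x`
has dimension at most `r - 1`; by Rees' theorem `M / xM` has again a regular sequence of length
`r - 1`. -/
theorem isWeaklyRegular_of_support {A : Type u} [CommRing A] [IsLocalRing A]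
    [IsNoetherianRing A] {M : Type u} [AddCommGroup M] [Module A M] [Module.Finite A M]
    [Nontrivial M] (rs xs : List A) (hlen : rs.length = xs.length)
    (memr : ∀ r ∈ rs, r ∈ maximalIdeal A) (reg : IsWeaklyRegular M rs)
    (memx : ∀ r ∈ xs, r ∈ maximalIdeal A)
    (hsupp : ∀ p ∈ support A M, (∀ x ∈ xs, x ∈ p.asIdeal) → p.asIdeal = maximalIdeal A) :
    IsWeaklyRegular M xs := by
  induction xs generalizing M rs with
  | nil => exact IsWeaklyRegular.nil _ _
  | cons x xs ih =>
    have hxm : x ∈ maximalIdeal A := memx x (by simp)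
    have hreg : IsSMulRegular M x := by
      set N := LinearMap.ker (LinearMap.lsmul A M x) with hN
      suffices hbot : N = ⊥ from LinearMap.ker_eq_bot.1 hbot
      refine Submodule.eq_bot_of_supportDim_lt_length rs memr reg N ?_
      refine (supportDim_le_supportDim_quotient_add_length xs
        (fun r hr => memx r (by simp [hr]))).trans_lt ?_
      have h0 : supportDim A (N ⧸ Ideal.ofList xs • (⊤ : Submodule A N)) ≤ 0 := by
        have : Subsingleton (support A (N ⧸ Ideal.ofList xs • (⊤ : Submodule A N))) := by
          have hmax : ∀ p ∈ support A (N ⧸ Ideal.ofList xs • (⊤ : Submodule A N)),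
              p.asIdeal = maximalIdeal A := by
            intro p hp
            have hpN : p ∈ support A N :=
              support_subset_of_surjective _ (Submodule.mkQ_surjective _) hp
            refine hsupp p (support_subset_of_injective _ N.injective_subtype hpN) ?_
            intro z hz
            rcases List.mem_cons.1 hz with rfl | hz
            · refine annihilator_le_of_mem_support hpN ?_
              rw [mem_annihilator]
              intro n
              exact Subtype.ext n.2
            · refine annihilator_le_of_mem_support hp ?_
              rw [mem_annihilator]
              intro n
              obtain ⟨n, rfl⟩ := Submodule.mkQ_surjective _ n
              rw [← map_smul]
              exact (Submodule.Quotient.mk_eq_zero _).2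
                (Submodule.smul_mem_smul (Ideal.subset_span hz) trivial)
          constructor
          rintro ⟨p, hp⟩ ⟨q, hq⟩
          apply Subtype.ext
          apply PrimeSpectrum.ext
          rw [hmax p hp, hmax q hq]
        exact Order.krullDim_nonpos_of_subsingleton
      refine (add_le_add_left h0 _).trans_lt ?_
      rw [hlen, zero_add, List.length_cons]
      exact_mod_cast Nat.lt_succ_self _
    have hnt : Nontrivial (QuotSMulTop x M) := nontrivial_quotSMulTop_of_mem_maximalIdeal M hxm
    have hlt : ∀ (L : Type u) [AddCommGroup L] [Module A L] [Module.Finite A L] [Nontrivial L],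
        maximalIdeal A • (⊤ : Submodule A L) < ⊤ := by
      intro L _ _ _ _
      exact (Submodule.top_ne_ideal_smul_of_le_jacobson_annihilator
        (maximalIdeal_le_jacobson _)).symm.lt_top
    have hsuppk : support A (ModuleCat.of A (A ⧸ maximalIdeal A)) =
        PrimeSpectrum.zeroLocus (maximalIdeal A) := by
      change support A (A ⧸ maximalIdeal A) = _
      rw [support_eq_zeroLocus, Ideal.annihilator_quotient]
    have hext := ModuleCat.subsingleton_ext_of_exists_isRegular (maximalIdeal A)
      (ModuleCat.of A (A ⧸ maximalIdeal A)) hsuppk.le (ModuleCat.of A M) (hlt M) rs memr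
      (IsRegular.of_isWeaklyRegular_of_mem_maximalIdeal M memr reg)
    obtain ⟨ys, hys, memy, regy⟩ := ModuleCat.exists_isRegular_of_exists_subsingleton_ext
      (maximalIdeal A) xs.length (ModuleCat.of A (QuotSMulTop x M)) (hlt _)
      (ModuleCat.of A (A ⧸ maximalIdeal A)) hsuppk (by
        intro i hi
        have zero1 := AddCommGrpCat.isZero_of_iff_subsingleton.mpr
          (hext i (by rw [hlen, List.length_cons]; omega))
        have zero2 := AddCommGrpCat.isZero_of_iff_subsingleton.mpr
          (hext (i + 1) (by rw [hlen, List.length_cons]; omega))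
        exact AddCommGrpCat.subsingleton_of_isZero <| ShortComplex.Exact.isZero_of_both_zeros
          ((Abelian.Ext.covariant_sequence_exact₃' _
            (IsSMulRegular.smulShortComplex_shortExact (M := ModuleCat.of A M) hreg) i (i + 1) rfl))
          (zero1.eq_zero_of_src _) (zero2.eq_zero_of_tgt _))
    refine IsWeaklyRegular.cons hreg (ih ys hys memy regy.toIsWeaklyRegular
      (fun r hr => memx r (by simp [hr])) ?_)
    intro p hp hpx
    rw [support_quotSMulTop] at hp
    refine hsupp p hp.1 ?_
    intro z hz
    rcases List.mem_cons.1 hz with rfl | hz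
    · simpa using hp.2
    · exact hpx z hz

/-! ### Forms and quasi-regular sequences -/

section Forms

variable {A : Type*} [CommRing A] {σ : Type*}

/-- The forms of degree `k` in the variables `X i`, `i ∈ s`, with all coefficients in the
ideal `M`. -/
def forms (s : Set σ) (M : Ideal A) (k : ℕ) : Submodule A (MvPolynomial σ A) where
  carrier := {φ | ∀ m, φ.coeff m ∈ M ∧ (φ.coeff m ≠ 0 → m.degree = k ∧ ∀ i ∈ m.support, i ∈ s)}
  zero_mem' := by simp
  add_mem' := by
    intro φ ψ hφ hψ m
    refine ⟨by simpa using M.add_mem (hφ m).1 (hψ m).1, fun h => ?_⟩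
    by_cases h1 : φ.coeff m = 0
    · exact (hψ m).2 fun h2 => h (by simp [h1, h2])
    · exact (hφ m).2 h1
  smul_mem' := by
    intro a φ hφ m
    refine ⟨by simpa using M.mul_mem_left a (hφ m).1, fun h => (hφ m).2 fun h1 => h (by simp [h1])⟩

variable {s t : Set σ} {M N : Ideal A} {k : ℕ} {φ ψ : MvPolynomial σ A}

theorem forms_mono (hs : s ⊆ t) (hM : M ≤ N) : forms s M k ≤ forms t N k :=
  fun _ hφ m => ⟨hM (hφ m).1, fun h => ⟨((hφ m).2 h).1, fun i hi => hs (((hφ m).2 h).2 i hi)⟩⟩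

theorem mem_forms_of_coeff_mem (hφ : φ ∈ forms s M k) (h : ∀ m, φ.coeff m ∈ N) :
    φ ∈ forms s N k :=
  fun m => ⟨h m, (hφ m).2⟩

theorem smul_mem_forms {a : A} (ha : a ∈ N) (hφ : φ ∈ forms s M k) :
    a • φ ∈ forms s (N * M) k :=
  mem_forms_of_coeff_mem ((forms s M k).smul_mem a hφ) fun m => by
    simpa using Ideal.mul_mem_mul ha (hφ m).1

theorem monomial_mem_forms {m : σ →₀ ℕ} {a : A} (ha : a ∈ M) (hm : m.degree = k)
    (hs : ∀ i ∈ m.support, i ∈ s) : MvPolynomial.monomial m a ∈ forms s M k := by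
  classical
  intro m'
  rw [MvPolynomial.coeff_monomial]
  split_ifs with h
  · subst h
    exact ⟨ha, fun _ => ⟨hm, hs⟩⟩
  · exact ⟨M.zero_mem, fun h => absurd rfl h⟩

theorem X_mul_mem_forms {i : σ} (hi : i ∈ s) (hφ : φ ∈ forms s M k) :
    MvPolynomial.X i * φ ∈ forms s M (k + 1) := by
  classical
  intro m
  rw [MvPolynomial.coeff_X_mul']
  split_ifs with h
  · refine ⟨(hφ _).1, fun h1 => ?_⟩
    obtain ⟨h2, h3⟩ := (hφ _).2 h1
    have h4 : m = (m - Finsupp.single i 1) + Finsupp.single i 1 := by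
      rw [tsub_add_cancel_of_le]
      rw [Finsupp.single_le_iff]
      exact Nat.one_le_iff_ne_zero.2 (Finsupp.mem_support_iff.1 h)
    refine ⟨by rw [h4, map_add, h2, Finsupp.degree_single], fun j hj => ?_⟩
    by_cases hji : j = i
    · exact hji ▸ hi
    · refine h3 j ?_
      rw [Finsupp.mem_support_iff] at hj ⊢
      simpa [Finsupp.single_apply, Ne.symm hji] using hj
  · exact ⟨M.zero_mem, fun h => absurd rfl h⟩

/-- A form splits along a sum of coefficient ideals. -/
theorem forms_sup_le : forms s (M ⊔ N) k ≤ forms s M k ⊔ forms s N k := by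
  intro φ hφ
  rw [φ.as_sum]
  refine Submodule.sum_mem _ fun m hm => ?_
  obtain ⟨h1, h2⟩ := hφ m
  obtain ⟨h3, h4⟩ := h2 (MvPolynomial.mem_support_iff.1 hm)
  obtain ⟨a, ha, b, hb, hab⟩ := Submodule.mem_sup.1 h1
  rw [← hab, map_add]
  exact Submodule.add_mem_sup (monomial_mem_forms ha h3 h4) (monomial_mem_forms hb h3 h4)

variable (x : σ → A)

theorem eval_mem_of_mem_forms (hφ : φ ∈ forms s M k) :
    MvPolynomial.eval x φ ∈ Ideal.span (x '' s) ^ k * M := by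
  rw [MvPolynomial.eval_eq]
  refine Ideal.sum_mem _ fun m hm => ?_
  obtain ⟨h1, h2⟩ := hφ m
  obtain ⟨h3, h4⟩ := h2 (MvPolynomial.mem_support_iff.1 hm)
  rw [mul_comm (φ.coeff m)]
  refine Ideal.mul_mem_mul ?_ h1
  rw [← h3, Finsupp.degree_apply, ← Finset.prod_pow_eq_pow_sum]
  exact Ideal.prod_mem_prod fun i hi =>
    Ideal.pow_mem_pow (Ideal.subset_span (Set.mem_image_of_mem x (h4 i hi))) _

/-- The elements of `(x i)_{i ∈ s} ^ k M` are the values of the forms of degree `k` with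
coefficients in `M`. -/
theorem exists_forms_eval_eq {z : A} (hz : z ∈ Ideal.span (x '' s) ^ k * M) :
    ∃ φ ∈ forms s M k, MvPolynomial.eval x φ = z := by
  induction k generalizing z with
  | zero =>
    refine ⟨MvPolynomial.C z, ?_, by simp⟩
    exact monomial_mem_forms (by simpa using hz) (by simp) (by simp)
  | succ k ih =>
    suffices h : Ideal.span (x '' s) ^ (k + 1) * M ≤
        (forms s M (k + 1)).map (MvPolynomial.aeval x).toLinearMap by
      obtain ⟨φ, hφ, h⟩ := h hz
      exact ⟨φ, hφ, by simpa [MvPolynomial.aeval_eq_eval] using h⟩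
    rw [pow_succ', mul_assoc, Ideal.span, ← smul_eq_mul, Submodule.span_smul_eq,
      Submodule.set_smul_le_iff]
    rintro _ z ⟨i, hi, rfl⟩ hz
    obtain ⟨φ, hφ, rfl⟩ := ih hz
    exact ⟨_, X_mul_mem_forms hi hφ, by simp [MvPolynomial.aeval_eq_eval]⟩

/-- The family `(x i)_{i ∈ s}` is quasi-regular on the ideal `M`: a form with coefficients in `M`
that vanishes at `x` has all its coefficients in `(x i)_{i ∈ s} M`. -/
def IsQuasiRegularOn (s : Set σ) (M : Ideal A) : Prop :=
  ∀ k, ∀ φ ∈ forms s M k, MvPolynomial.eval x φ = 0 → ∀ m, φ.coeff m ∈ Ideal.span (x '' s) * M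

variable {x}

theorem coeff_eq_zero_of_eval_eq_zero (hφ : ∀ m, m ≠ 0 → φ.coeff m = 0)
    (h0 : MvPolynomial.eval x φ = 0) (m : σ →₀ ℕ) : φ.coeff m = 0 := by
  classical
  have h2 : φ = MvPolynomial.C (φ.coeff 0) := by
    ext m
    rw [MvPolynomial.coeff_C]
    split_ifs with h
    · rw [h]
    · exact hφ m (Ne.symm h)
  rw [h2, MvPolynomial.eval_C] at h0
  rw [h2, h0]
  simp

theorem isQuasiRegularOn_empty : IsQuasiRegularOn x ∅ M := by
  intro k φ hφ h0 m
  rw [coeff_eq_zero_of_eval_eq_zero (fun m hm => ?_) h0]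
  · exact Ideal.zero_mem _
  · by_contra h
    obtain ⟨i, hi⟩ := Finsupp.support_nonempty_iff.2 hm
    exact ((hφ m).2 h).2 i hi

/-- If an element is a nonzerodivisor modulo `(x) M` and `x` is quasi-regular on `M`, then it is a
nonzerodivisor modulo `(x) ^ k M` for all `k`. -/
theorem IsQuasiRegularOn.mem_of_mul_mem (hq : IsQuasiRegularOn x s M) {y : A}
    (hy : ∀ z ∈ M, y * z ∈ Ideal.span (x '' s) * M → z ∈ Ideal.span (x '' s) * M) (k : ℕ) {z : A}
    (hz : z ∈ M) (hyz : y * z ∈ Ideal.span (x '' s) ^ k * M) :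
    z ∈ Ideal.span (x '' s) ^ k * M := by
  induction k with
  | zero => simpa using hz
  | succ k ih =>
    rw [pow_succ, mul_assoc] at hyz ⊢
    have hle : Ideal.span (x '' s) ^ k * (Ideal.span (x '' s) * M) ≤ Ideal.span (x '' s) ^ k * M :=
      Ideal.mul_mono_right Ideal.mul_le_right
    have hyz' : y * z ∈ Ideal.span (x '' s) ^ k * M := hle hyz
    obtain ⟨φ, hφ, rfl⟩ := exists_forms_eval_eq x (ih hyz')
    obtain ⟨ψ, hψ, h⟩ := exists_forms_eval_eq x hyz
    refine eval_mem_of_mem_forms x (mem_forms_of_coeff_mem hφ fun m => hy _ (hφ m).1 ?_)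
    have h1 := hq k (y • φ - ψ) (Submodule.sub_mem _ (Submodule.smul_mem _ _ hφ)
      (forms_mono le_rfl Ideal.mul_le_right hψ)) (by simp [h, MvPolynomial.smul_eval]) m
    simpa using Ideal.add_mem _ h1 (hψ m).1

/-- Quasi-regularity is preserved when an element that is regular modulo the previous ones is
appended. -/
theorem isQuasiRegularOn_insert (hq : IsQuasiRegularOn x s M) {i : σ}
    (hy : ∀ z ∈ M, x i * z ∈ Ideal.span (x '' s) * M → z ∈ Ideal.span (x '' s) * M) :
    IsQuasiRegularOn x (insert i s) M := by
  intro k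
  have hQ : Ideal.span (x '' s) ≤ Ideal.span (x '' insert i s) :=
    Ideal.span_mono (Set.image_mono (Set.subset_insert i s))
  induction k with
  | zero =>
    intro φ hφ h0 m
    rw [coeff_eq_zero_of_eval_eq_zero (fun m hm => ?_) h0]
    · exact Ideal.zero_mem _
    · by_contra h
      exact hm ((Finsupp.degree_eq_zero_iff m).1 ((hφ m).2 h).1)
  | succ k ih =>
    intro φ hφ h0
    set ψ := MvPolynomial.divMonomial φ (Finsupp.single i 1) with hψdef
    set θ := MvPolynomial.modMonomial φ (Finsupp.single i 1) with hθdef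
    have hdecomp : MvPolynomial.X i * ψ + θ = φ :=
      MvPolynomial.divMonomial_add_modMonomial_single φ i
    have hψ : ψ ∈ forms (insert i s) M k := by
      intro m
      rw [hψdef, MvPolynomial.coeff_divMonomial]
      refine ⟨(hφ _).1, fun h => ?_⟩
      obtain ⟨h1, h2⟩ := (hφ _).2 h
      rw [map_add, Finsupp.degree_single] at h1
      refine ⟨by omega, fun j hj => h2 j ?_⟩
      rw [Finsupp.mem_support_iff] at hj ⊢
      rw [Finsupp.add_apply]
      omega
    have hθ : θ ∈ forms s M (k + 1) := by
      intro m
      by_cases hm : Finsupp.single i 1 ≤ m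
      · rw [hθdef, MvPolynomial.coeff_modMonomial_of_le _ hm]
        exact ⟨M.zero_mem, fun h => absurd rfl h⟩
      · rw [hθdef, MvPolynomial.coeff_modMonomial_of_not_le _ hm]
        refine ⟨(hφ m).1, fun h => ⟨((hφ m).2 h).1, fun j hj => ?_⟩⟩
        refine (((hφ m).2 h).2 j hj).resolve_left fun hji => hm ?_
        rw [Finsupp.single_le_iff]
        exact Nat.one_le_iff_ne_zero.2 (Finsupp.mem_support_iff.1 (hji ▸ hj))
    have hev : x i * MvPolynomial.eval x ψ + MvPolynomial.eval x θ = 0 := by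
      rw [← h0, ← hdecomp]
      simp
    have hle : Ideal.span (x '' insert i s) ^ k * M ≤ M := Ideal.mul_le_right
    have hψM : MvPolynomial.eval x ψ ∈ M := hle (eval_mem_of_mem_forms x hψ)
    have hψx : MvPolynomial.eval x ψ ∈ Ideal.span (x '' s) ^ (k + 1) * M := by
      refine hq.mem_of_mul_mem hy (k + 1) hψM ?_
      rw [eq_neg_of_add_eq_zero_left hev]
      exact neg_mem (eval_mem_of_mem_forms x hθ)
    have hψc : ∀ m, ψ.coeff m ∈ Ideal.span (x '' insert i s) * M := by
      intro m
      rw [pow_succ, mul_assoc] at hψx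
      obtain ⟨η, hη, h⟩ := exists_forms_eval_eq x hψx
      have h1 := ih (ψ - η) (Submodule.sub_mem _ hψ
        (forms_mono (Set.subset_insert i s) Ideal.mul_le_right hη)) (by simp [h]) m
      simpa using Ideal.add_mem _ h1 (Ideal.mul_mono_left hQ (hη m).1)
    have hθc : ∀ m, θ.coeff m ∈ Ideal.span (x '' insert i s) * M := by
      intro m
      obtain ⟨η, hη, h⟩ := exists_forms_eval_eq x hψx
      have h1 := hq (k + 1) (θ + x i • η) (Submodule.add_mem _ hθ (Submodule.smul_mem _ _ hη))
        (by simp [h, MvPolynomial.smul_eval, ← hev, add_comm]) m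
      have h2 : x i * η.coeff m ∈ Ideal.span (x '' insert i s) * M :=
        Ideal.mul_mem_mul (Ideal.subset_span ⟨i, Set.mem_insert i s, rfl⟩) (hη m).1
      simpa using Ideal.sub_mem _ (Ideal.mul_mono_left hQ h1) h2
    intro m
    by_cases hm : Finsupp.single i 1 ≤ m
    · have := hψc (m - Finsupp.single i 1)
      rwa [hψdef, MvPolynomial.coeff_divMonomial, add_tsub_cancel_of_le hm] at this
    · have := hθc m
      rwa [hθdef, MvPolynomial.coeff_modMonomial_of_not_le _ hm] at this

end Forms

/-! ### Lengths of powers times ideals -/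

section Independence

variable {A : Type*} [CommRing A] {σ : Type*}

/-- The coefficients of forms are determined modulo `N'`: a form with coefficients in `N` whose
value at `x` lies in `(x) ^ k N'` has all its coefficients in `N'`. If `N' ≤ N`, this says that
`⨁ (x) ^ k N / (x) ^ k N'` is the polynomial ring over `A` tensored with `N / N'`. -/
def HasIndependentCoeffs (x : σ → A) (N N' : Ideal A) : Prop :=
  ∀ k, ∀ φ ∈ forms Set.univ N k, MvPolynomial.eval x φ ∈ Ideal.span (Set.range x) ^ k * N' →
    φ ∈ forms Set.univ N' k

variable {x : σ → A} {I J N N' : Ideal A}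

theorem IsQuasiRegularOn.hasIndependentCoeffs (hq : IsQuasiRegularOn x Set.univ N)
    (h : Ideal.span (Set.range x) * N ≤ N') (hN : N' ≤ N) : HasIndependentCoeffs x N N' := by
  intro k φ hφ hx
  rw [← Set.image_univ] at hx h
  obtain ⟨ψ, hψ, hψx⟩ := exists_forms_eval_eq x hx
  refine mem_forms_of_coeff_mem hφ fun m => ?_
  have h1 := hq k (φ - ψ) (Submodule.sub_mem _ hφ (forms_mono le_rfl hN hψ)) (by simp [hψx]) m
  simpa using Ideal.add_mem _ (h h1) (hψ m).1

/-- Let `Q = (x)`, `J = I + Q` with `x i₀ ∈ I`, where `x` is regular on `I` with `x i₀` as last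
term. Then `Q ^ k J ^ 2 / Q ^ (k + 1) J` is free over `J ^ 2 / Q J` on the monomials of degree `k`.
As `J ^ 2 = I ^ 2 + Q J`, only forms with coefficients in `I ^ 2 ≤ I` matter, and these are
governed by quasi-regularity on `I`, because `I ∩ Q ^ (k + 1) J ≤ Q ^ (k + 1) I`: multiplication by
`x i₀` carries `I ∩ Q₀ ^ (k + 2)` into `Q₀ ^ (k + 2) I`, where `Q₀` is generated by the other
terms. -/
theorem hasIndependentCoeffs_sq_mul {i₀ : σ} (hi₀ : x i₀ ∈ I)
    (hq₀ : IsQuasiRegularOn x {i₀}ᶜ I)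
    (hreg : ∀ z ∈ I, x i₀ * z ∈ Ideal.span (x '' {i₀}ᶜ) * I → z ∈ Ideal.span (x '' {i₀}ᶜ) * I)
    (hJ : J = I ⊔ Ideal.span (Set.range x)) :
    HasIndependentCoeffs x (J ^ 2) (Ideal.span (Set.range x) * J) := by
  have hq : IsQuasiRegularOn x Set.univ I := by
    have := isQuasiRegularOn_insert hq₀ hreg
    rwa [Set.insert_eq, Set.union_compl_self] at this
  set Q := Ideal.span (Set.range x) with hQ
  set Q₀ := Ideal.span (x '' {i₀}ᶜ) with hQ₀
  have hQ₀Q : Q₀ ≤ Q := Ideal.span_mono (Set.image_subset_range _ _)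
  have hQle : Q ≤ I ⊔ Q₀ := by
    rw [hQ, Ideal.span_le]
    rintro _ ⟨i, rfl⟩
    by_cases hi : i = i₀
    · exact Ideal.mem_sup_left (hi ▸ hi₀)
    · exact Ideal.mem_sup_right (Ideal.subset_span ⟨i, hi, rfl⟩)
  have hJ₀ : J = I ⊔ Q₀ := by
    rw [hJ]
    exact le_antisymm (sup_le le_sup_left hQle) (sup_le_sup_left hQ₀Q I)
  have hJ2 : J ^ 2 ≤ I ⊔ Q * J := by
    conv_lhs => rw [pow_two, hJ, Ideal.sup_mul, ← hJ]
    exact sup_le_sup_right Ideal.mul_le_left _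
  have hpow : ∀ k, Q ^ (k + 1) ≤ Q ^ k * I ⊔ Q₀ ^ (k + 1) := by
    intro k
    induction k with
    | zero => simpa using hQle
    | succ k ih =>
      rw [pow_succ Q (k + 1)]
      refine (Ideal.mul_mono_left ih).trans ?_
      rw [Ideal.sup_mul]
      refine sup_le (le_sup_of_le_left (le_of_eq (by ring))) ?_
      refine (Ideal.mul_mono_right hQle).trans ?_
      rw [Ideal.mul_sup]
      exact sup_le_sup (Ideal.mul_mono_left (Ideal.pow_right_mono hQ₀Q _)) (pow_succ Q₀ _).ge
  have hinter : ∀ k, ∀ z ∈ I, z ∈ Q ^ k * (Q * J) → z ∈ Q ^ k * (Q * I) := by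
    intro k z hzI hz
    have hle : Q ^ k * (Q * J) ≤ Q ^ (k + 1) * I ⊔ Q₀ ^ (k + 2) := by
      rw [← mul_assoc, ← pow_succ, hJ₀, Ideal.mul_sup]
      refine sup_le le_sup_left ((Ideal.mul_mono_left (hpow k)).trans ?_)
      rw [Ideal.sup_mul, ← pow_succ]
      refine sup_le_sup_right ?_ _
      calc Q ^ k * I * Q₀ ≤ Q ^ k * I * Q := Ideal.mul_mono_right hQ₀Q
        _ = Q ^ (k + 1) * I := by ring
    obtain ⟨u, hu, v, hv, rfl⟩ := Submodule.mem_sup.1 (hle hz)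
    have huI : u ∈ I := (Ideal.mul_le_right : Q ^ (k + 1) * I ≤ I) hu
    have hvI : v ∈ I := (Ideal.add_mem_iff_right I huI).1 hzI
    have hv' : v ∈ Q₀ ^ (k + 2) * I := by
      refine hq₀.mem_of_mul_mem hreg (k + 2) hvI ?_
      rw [mul_comm (x i₀)]
      exact Ideal.mul_mem_mul hv hi₀
    have hle' : Q₀ ^ (k + 2) * I ≤ Q ^ (k + 1) * I :=
      Ideal.mul_mono_left ((Ideal.pow_right_mono hQ₀Q _).trans (Ideal.pow_le_pow_right (by omega)))
    rw [← mul_assoc, ← pow_succ]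
    exact Ideal.add_mem _ hu (hle' hv')
  intro k φ hφ hx
  obtain ⟨φ₁, h₁, φ₂, h₂, rfl⟩ :=
    Submodule.mem_sup.1 (forms_sup_le (forms_mono le_rfl hJ2 hφ))
  have hx₂ := eval_mem_of_mem_forms x h₂
  have hx₁ := eval_mem_of_mem_forms x h₁
  rw [Set.image_univ] at hx₁ hx₂
  rw [map_add] at hx
  have h3 := hinter k _ ((Ideal.mul_le_right : Q ^ k * I ≤ I) hx₁)
    ((Ideal.add_mem_iff_left _ hx₂).1 hx)
  have h4 : φ₁ ∈ forms Set.univ (Q * I) k := hq.hasIndependentCoeffs le_rfl Ideal.mul_le_right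
    k φ₁ h₁ h3
  refine Submodule.add_mem _ (forms_mono le_rfl (Ideal.mul_mono_right ?_) h4) h₂
  exact hJ ▸ le_sup_left

variable [Fintype σ]

/-- The number of monomials of degree `k` times `ℓ(N / N')`. -/
theorem length_pow_mul_quotient (h : HasIndependentCoeffs x N N') (k : ℕ) :
    Module.length A (↥(Ideal.span (Set.range x) ^ k * N) ⧸
      Submodule.comap (Ideal.span (Set.range x) ^ k * N).subtype
        (Ideal.span (Set.range x) ^ k * N')) =
    (Fintype.card σ).multichoose k * Module.length A (N ⧸ Submodule.comap N.subtype N') := by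
  classical
  set Q := Ideal.span (Set.range x) with hQ
  set D : Finset (σ →₀ ℕ) := Finset.univ.finsuppAntidiag k with hDdef
  have hD : ∀ m : σ →₀ ℕ, m ∈ D ↔ m.degree = k := by
    intro m
    simp [hDdef, Finset.mem_finsuppAntidiag, Finsupp.degree_eq_sum]
  let F : (D → N) →ₗ[A] MvPolynomial σ A :=
    ∑ m : D, (MvPolynomial.monomial m.1) ∘ₗ N.subtype ∘ₗ LinearMap.proj m
  have hFc : ∀ (c : D → N) (m : D), (F c).coeff m.1 = c m := by
    intro c m
    simp [F, MvPolynomial.coeff_sum, MvPolynomial.coeff_monomial]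
  have hF : ∀ (L : Ideal A) (c : D → N), F c ∈ forms Set.univ L k ↔ ∀ m, (c m : A) ∈ L := by
    intro L c
    refine ⟨fun h1 m => hFc c m ▸ (h1 m.1).1, fun h1 => ?_⟩
    simp only [F, LinearMap.sum_apply]
    exact Submodule.sum_mem _ fun m _ =>
      monomial_mem_forms (h1 m) ((hD _).1 m.2) fun i _ => Set.mem_univ i
  have hmem : ∀ c, ((MvPolynomial.aeval x).toLinearMap ∘ₗ F) c ∈ Q ^ k * N := by
    intro c
    have := eval_mem_of_mem_forms x ((hF N c).2 fun m => (c m).2)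
    rw [Set.image_univ] at this
    simpa [MvPolynomial.aeval_eq_eval] using this
  let G : (D → N) →ₗ[A] ↥(Q ^ k * N) :=
    ((MvPolynomial.aeval x).toLinearMap ∘ₗ F).codRestrict (Q ^ k * N) hmem
  have hG : ∀ c, (G c : A) = MvPolynomial.eval x (F c) := by
    intro c
    simp [G, MvPolynomial.aeval_eq_eval]
  have hsurj : Function.Surjective G := by
    rintro ⟨z, hz⟩
    have hz' := hz
    rw [hQ, ← Set.image_univ] at hz'
    obtain ⟨φ, hφ, hφz⟩ := exists_forms_eval_eq x hz'
    refine ⟨fun m => ⟨φ.coeff m.1, (hφ m.1).1⟩, Subtype.ext ?_⟩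
    refine (hG _).trans (Eq.trans (congrArg _ ?_) hφz)
    ext m
    by_cases hm : m ∈ D
    · exact hFc _ ⟨m, hm⟩
    · rw [hD] at hm
      have h1 := (hF N (fun m => ⟨φ.coeff m.1, (hφ m.1).1⟩)).2 fun m => (hφ m.1).1
      rw [not_not.1 fun h2 => hm ((h1 m).2 h2).1, not_not.1 fun h2 => hm ((hφ m).2 h2).1]
  have hker : (Submodule.comap (Q ^ k * N).subtype (Q ^ k * N')).comap G =
      Submodule.pi Set.univ fun _ : D => Submodule.comap N.subtype N' := by
    ext c
    rw [Submodule.mem_comap, Submodule.mem_comap, Submodule.subtype_apply, hG, Submodule.mem_pi]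
    refine ⟨fun h2 m _ => ?_, fun h2 => ?_⟩
    · exact (hF N' c).1 (h k _ ((hF N c).2 fun m => (c m).2) h2) m
    · have := eval_mem_of_mem_forms x ((hF N' c).2 fun m => h2 m trivial)
      rwa [Set.image_univ] at this
  have hker' : LinearMap.ker
      (Submodule.mkQ (Submodule.comap (Q ^ k * N).subtype (Q ^ k * N')) ∘ₗ G) =
      Submodule.pi Set.univ fun _ : D => Submodule.comap N.subtype N' := by
    rw [LinearMap.ker_comp, Submodule.ker_mkQ, hker]
  have hsurj' : Function.Surjective
      (Submodule.mkQ (Submodule.comap (Q ^ k * N).subtype (Q ^ k * N')) ∘ₗ G) := by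
    rw [LinearMap.coe_comp]
    exact (Submodule.mkQ_surjective _).comp hsurj
  rw [← (LinearMap.quotKerEquivOfSurjective _ hsurj').length_eq,
    (Submodule.quotEquivOfEq _ _ hker').length_eq, (Submodule.quotientPi _).length_eq,
    Module.length_pi, ENat.card_eq_coe_fintype_card, Fintype.card_coe, hDdef,
    Finset.card_finsuppAntidiag_nat_eq_multichoose, Finset.card_univ]

end Independence

theorem length_quotient_eq_add {A : Type*} [CommRing A] {N N' : Ideal A} (h : N' ≤ N) :
    Module.length A (A ⧸ N') =
      Module.length A (A ⧸ N) + Module.length A (N ⧸ Submodule.comap N.subtype N') := by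
  rw [add_comm]
  refine Module.length_eq_add_of_exact
    (Submodule.mapQ (Submodule.comap N.subtype N') N' N.subtype le_rfl)
    (Submodule.factor h) ?_ (Submodule.factor_surjective h) ?_
  · rw [← LinearMap.ker_eq_bot, Submodule.ker_mapQ]
    simp
  · rw [LinearMap.exact_iff, Submodule.factor, Submodule.mapQ, Submodule.ker_liftQ,
      Submodule.range_mapQ]
    simp

/-! ### The rank of the Sally module -/

section SallyRank

variable {A : Type*} [CommRing A]

/-- The polynomials whose coefficient of `t ^ l` lies in `𝒩 l` form a submodule over the Rees
algebra of `Q` if `Q ^ i * 𝒩 j ≤ 𝒩 (i + j)`. -/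
noncomputable def coeffSubmodule (Q : Ideal A) (𝒩 : ℕ → Ideal A)
    (h : ∀ i j, Q ^ i * 𝒩 j ≤ 𝒩 (i + j)) :
    Submodule (reesAlgebra Q) A[X] where
  carrier := {f | ∀ l, f.coeff l ∈ 𝒩 l}
  zero_mem' := by simp
  add_mem' := fun hf hg l => by simpa using Ideal.add_mem _ (hf l) (hg l)
  smul_mem' := by
    intro r f hf l
    rw [Algebra.smul_def, Polynomial.coeff_mul]
    refine Ideal.sum_mem _ fun ij hij => ?_
    rw [← Finset.HasAntidiagonal.mem_antidiagonal.1 hij]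
    exact h _ _ (Ideal.mul_mem_mul ((mem_reesAlgebra_iff _ _).1 r.2 _) (hf _))

variable {J Q L N N' : Ideal A}

theorem mulRees_le_coeffSubmodule {𝒩 : ℕ → Ideal A} {h : ∀ i j, Q ^ i * 𝒩 j ≤ 𝒩 (i + j)}
    (hL : ∀ l, J * L ^ l ≤ 𝒩 l) : mulRees J Q L ≤ coeffSubmodule Q 𝒩 h := by
  refine Submodule.span_le.2 ?_
  rintro _ ⟨a, ha, g, hg, rfl⟩ l
  rw [Polynomial.coeff_C_mul]
  exact hL l (Ideal.mul_mem_mul ha ((mem_reesAlgebra_iff _ _).1 hg l))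

theorem monomial_mem_mulRees {l : ℕ} {c : A} (hc : c ∈ J * L ^ l) :
    Polynomial.monomial l c ∈ mulRees J Q L := by
  refine Submodule.mul_induction_on hc (fun a ha b hb => ?_) fun a b ha hb => ?_
  · refine Submodule.subset_span ⟨a, ha, Polynomial.monomial l b,
      reesAlgebra.monomial_mem.2 hb, ?_⟩
    rw [Polynomial.C_mul_monomial]
  · rw [map_add]
    exact Submodule.add_mem _ ha hb

theorem monomial_mem_mulRees_self_iff (hQJ : Q ≤ J) {l : ℕ} {c : A} :
    Polynomial.monomial l c ∈ mulRees J Q J ↔ c ∈ J ^ (l + 1) := by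
  rw [pow_succ']
  refine ⟨fun h => ?_, monomial_mem_mulRees⟩
  have h1 : mulRees J Q J ≤ coeffSubmodule Q (fun l => J * J ^ l) (by
      intro i j
      refine (Ideal.mul_mono_left (Ideal.pow_right_mono hQJ i)).trans (le_of_eq ?_)
      ring) := mulRees_le_coeffSubmodule fun _ => le_rfl
  simpa using h1 h l

/-- The submodule of `A[t] / J R(Q)` generated by the classes of `c t`, `c ∈ N`. -/
noncomputable def spanDegreeOne (J Q N : Ideal A) :
    Submodule (reesAlgebra Q) (A[X] ⧸ mulRees J Q Q) :=
  Submodule.span (reesAlgebra Q)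
    ((fun c => (mulRees J Q Q).mkQ (Polynomial.monomial 1 c)) '' N)

theorem algebraMap_smul_mkQ_monomial (r c : A) :
    algebraMap A (reesAlgebra Q) r • (mulRees J Q Q).mkQ (Polynomial.monomial 1 c) =
      (mulRees J Q Q).mkQ (Polynomial.monomial 1 (r * c)) := by
  rw [← map_smul, Algebra.smul_def, ← Polynomial.C_mul_monomial]
  rfl

theorem mkQ_monomial_mem_spanDegreeOne {c : A} (hc : c ∈ N) :
    (mulRees J Q Q).mkQ (Polynomial.monomial 1 c) ∈ spanDegreeOne J Q N :=
  Submodule.subset_span ⟨c, hc, rfl⟩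

theorem spanDegreeOne_mono (h : N ≤ N') : spanDegreeOne J Q N ≤ spanDegreeOne J Q N' :=
  Submodule.span_mono (Set.image_mono h)

theorem spanDegreeOne_mul : spanDegreeOne J Q (Q * J) = ⊥ := by
  rw [eq_bot_iff, spanDegreeOne, Submodule.span_le]
  rintro _ ⟨c, hc, rfl⟩
  refine (Submodule.Quotient.mk_eq_zero _).2 (monomial_mem_mulRees ?_)
  rw [pow_one, mul_comm]
  exact hc

theorem coeff_mem_of_mkQ_mem_spanDegreeOne (hN : Q * J ≤ N) {f : A[X]}
    (hf : (mulRees J Q Q).mkQ f ∈ spanDegreeOne J Q N) (k : ℕ) :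
    f.coeff (k + 1) ∈ Q ^ k * N := by
  -- In degree zero the coefficients of `J R(Q)` have to be allowed; they lie in `J`.
  let 𝒩 : ℕ → Ideal A := fun l => if l = 0 then J else Q ^ (l - 1) * N
  have h𝒩 : ∀ i j, Q ^ i * 𝒩 j ≤ 𝒩 (i + j) := by
    intro i j
    rcases j with _ | j
    · rcases i with _ | i
      · simp [𝒩]
      · simp only [𝒩, if_true, Nat.add_zero, Nat.add_one_ne_zero, if_false, Nat.add_sub_cancel]
        rw [pow_succ, mul_assoc]
        exact Ideal.mul_mono_right hN
    · simp only [𝒩, Nat.add_one_ne_zero, if_false, ← Nat.add_assoc, Nat.add_sub_cancel]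
      exact le_of_eq (by ring)
  have h1 : mulRees J Q Q ≤ coeffSubmodule Q 𝒩 h𝒩 := by
    refine mulRees_le_coeffSubmodule fun l => ?_
    rcases l with _ | l
    · simp [𝒩]
    · refine le_trans (le_of_eq ?_) (Ideal.mul_mono_right hN : Q ^ l * (Q * J) ≤ _)
      ring
  have h2 : spanDegreeOne J Q N ≤ (coeffSubmodule Q 𝒩 h𝒩).map (mulRees J Q Q).mkQ := by
    refine Submodule.span_le.2 ?_
    rintro _ ⟨c, hc, rfl⟩
    refine Submodule.mem_map_of_mem fun l => ?_
    rcases l with _ | _ | l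
    · simp [𝒩, Polynomial.coeff_monomial]
    · simpa [𝒩] using hc
    · rw [Polynomial.coeff_monomial_of_ne _ (by omega)]
      exact Ideal.zero_mem _
  have h3 : f ∈ ((coeffSubmodule Q 𝒩 h𝒩).map (mulRees J Q Q).mkQ).comap (mulRees J Q Q).mkQ :=
    h2 hf
  rw [Submodule.comap_map_mkQ, sup_eq_right.2 h1] at h3
  exact h3 (k + 1)

theorem SallyGeneratedInDegreeOne.sallyModule_eq (h : SallyGeneratedInDegreeOne J Q) (hQJ : Q ≤ J) :
    sallyModule J Q = spanDegreeOne J Q (J ^ 2) := by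
  rw [h, spanDegreeOne]
  congr 1
  ext z
  constructor
  · rintro ⟨c, hc, rfl⟩
    exact ⟨c, (monomial_mem_mulRees_self_iff hQJ).1 hc, rfl⟩
  · rintro ⟨c, hc, rfl⟩
    exact ⟨c, (monomial_mem_mulRees_self_iff hQJ).2 hc, rfl⟩

/-- If the Sally module is generated in degree one, then `J ^ 3 = Q J ^ 2`, and so on. -/
theorem SallyGeneratedInDegreeOne.pow_eq (h : SallyGeneratedInDegreeOne J Q) (hQJ : Q ≤ J) (k : ℕ) :
    J ^ (k + 2) = Q ^ k * J ^ 2 := by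
  refine le_antisymm (fun c hc => ?_) ?_
  · have h1 : (mulRees J Q Q).mkQ (Polynomial.monomial (k + 1) c) ∈ sallyModule J Q :=
      Submodule.mem_map_of_mem ((monomial_mem_mulRees_self_iff hQJ).2 hc)
    rw [h.sallyModule_eq hQJ] at h1
    have h2 : Q * J ≤ J ^ 2 := by
      rw [pow_two]
      exact Ideal.mul_mono_left hQJ
    simpa using coeff_mem_of_mkQ_mem_spanDegreeOne h2 h1 k
  · rw [pow_add]
    exact Ideal.mul_mono_left (Ideal.pow_right_mono hQJ k)

/-- An extension of submodules whose quotient is generated by one element `x`, killed by the prime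
`p` but by no element outside `p`, becomes a covering relation after localization at `p`. -/
theorem Submodule.localized_covBy {T : Type*} [CommRing T] (p : Ideal T) [p.IsPrime] {S : Type*}
    [AddCommGroup S] [Module T S] {F₁ F₂ : Submodule T S} (hle : F₁ ≤ F₂) {x : S} (hx : x ∈ F₂)
    (hF₂ : ∀ z ∈ F₂, ∃ t : T, z - t • x ∈ F₁) (hp : ∀ t ∈ p, t • x ∈ F₁)
    (hs : ∀ s ∉ p, s • x ∉ F₁) :
    F₁.localized p.primeCompl ⋖ F₂.localized p.primeCompl := by
  set f := LocalizedModule.mkLinearMap p.primeCompl S with hf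
  have hmem : ∀ {F : Submodule T S} {z : S}, z ∈ F → f z ∈ F.localized p.primeCompl := by
    intro F z hz
    exact (Submodule.mem_localized' _ _ _ _ _).2 ⟨z, hz, 1, by simp [hf]⟩
  have hmono : F₁.localized p.primeCompl ≤ F₂.localized p.primeCompl :=
    (Submodule.localized'gi (Localization p.primeCompl) p.primeCompl f).gc.monotone_l hle
  have hxn : f x ∉ F₁.localized p.primeCompl := by
    intro h
    obtain ⟨m, hm, s, h⟩ := (Submodule.mem_localized' _ _ _ _ _).1 h
    rw [IsLocalizedModule.mk'_eq_iff, Submonoid.smul_def, ← map_smul,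
      IsLocalizedModule.eq_iff_exists p.primeCompl] at h
    obtain ⟨u, hu⟩ := h
    refine hs (u * s : p.primeCompl) (u * s).2 ?_
    rw [Submonoid.coe_mul, mul_smul]
    change u • (s : T) • x ∈ F₁
    rw [← hu]
    exact F₁.smul_mem _ hm
  have hdecomp : ∀ w ∈ F₂.localized p.primeCompl, ∃ r : Localization p.primeCompl,
      w - r • f x ∈ F₁.localized p.primeCompl := by
    intro w hw
    obtain ⟨m, hm, s, rfl⟩ := (Submodule.mem_localized' _ _ _ _ _).1 hw
    obtain ⟨t, ht⟩ := hF₂ m hm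
    refine ⟨IsLocalization.mk' _ t s, ?_⟩
    rw [← IsLocalizedModule.mk'_one p.primeCompl f x, IsLocalizedModule.mk'_smul_mk', mul_one,
      ← IsLocalizedModule.mk'_sub]
    exact (Submodule.mem_localized' _ _ _ _ _).2 ⟨_, ht, s, rfl⟩
  have hpx : ∀ r : Localization p.primeCompl, ¬ IsUnit r → r • f x ∈ F₁.localized p.primeCompl := by
    intro r hr
    obtain ⟨t, s, rfl⟩ := IsLocalization.exists_mk'_eq p.primeCompl r
    have ht : t ∈ p := by
      by_contra ht
      exact hr ((IsLocalization.AtPrime.isUnit_mk'_iff (Localization.AtPrime p) p t s).2 ht)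
    rw [← IsLocalizedModule.mk'_one p.primeCompl f x, IsLocalizedModule.mk'_smul_mk', mul_one]
    exact (Submodule.mem_localized' _ _ _ _ _).2 ⟨_, hp t ht, s, rfl⟩
  refine ⟨lt_of_le_not_ge hmono fun h => hxn (h (hmem hx)), ?_⟩
  intro W h1 h2
  obtain ⟨w, hwW, hw⟩ := Set.exists_of_ssubset h1
  obtain ⟨r, hr⟩ := hdecomp w (h2.le hwW)
  have hru : IsUnit r := by
    by_contra hru
    exact hw (by simpa using Submodule.add_mem _ hr (hpx r hru))
  have hfx : f x ∈ W := by
    have h3 : r • f x ∈ W := by simpa using Submodule.sub_mem _ hwW (h1.le hr)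
    exact (Submodule.smul_mem_iff_of_isUnit _ hru).1 h3
  refine h2.not_ge fun z hz => ?_
  obtain ⟨r', hr'⟩ := hdecomp z hz
  simpa using Submodule.add_mem _ (h1.le hr') (W.smul_mem r' hfx)

/-- Lengths agree along a map of submodule lattices that preserves covering relations, bottom and
top, since it carries composition series to composition series. -/
theorem length_eq_of_covBy_map {R R' M M' : Type*} [CommRing R] [CommRing R'] [AddCommGroup M]
    [Module R M] [AddCommGroup M'] [Module R' M'] (G : Submodule R M → Submodule R' M')
    (hcov : ∀ {V V'}, V ⋖ V' → G V ⋖ G V') (hbot : G ⊥ = ⊥) (htop : G ⊤ = ⊤)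
    (hfin : Module.length R M ≠ ⊤) : Module.length R' M' = Module.length R M := by
  obtain ⟨s, hs₁, hs₂⟩ := isFiniteLength_iff_exists_compositionSeries.1
    (Module.length_ne_top_iff.1 hfin)
  rw [← Module.length_compositionSeries s hs₁ hs₂]
  let s' : CompositionSeries (Submodule R' M') := s.map ⟨G, fun h => hcov h⟩
  rw [← Module.length_compositionSeries s' (by rw [RelSeries.head_map, hs₁]; exact hbot)
    (by rw [RelSeries.last_map, hs₂]; exact htop)]
  rfl

/-- If `s ∉ m R(Q)`, some coefficient of `s` is a form in the generators of `Q` with a unit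
coefficient. -/
theorem exists_forms_isUnit_coeff [IsLocalRing A] {σ : Type*} {x : σ → A}
    (hQ : Q = Ideal.span (Set.range x)) {s : reesAlgebra Q}
    (hs : s ∉ (IsLocalRing.maximalIdeal A).map (algebraMap A (reesAlgebra Q))) :
    ∃ k, ∃ φ ∈ forms Set.univ (⊤ : Ideal A) k, MvPolynomial.eval x φ = (s : A[X]).coeff k ∧
      ∃ m, IsUnit (φ.coeff m) := by
  set P := (IsLocalRing.maximalIdeal A).map (algebraMap A (reesAlgebra Q)) with hP
  by_contra hcon
  push Not at hcon
  apply hs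
  have hmon : ∀ k, ∀ c ∈ IsLocalRing.maximalIdeal A * Q ^ k,
      ∃ u ∈ P, (u : A[X]) = Polynomial.monomial k c := by
    intro k c hc
    refine Submodule.mul_induction_on hc (fun a ha b hb => ?_) fun a b ha hb => ?_
    · refine ⟨algebraMap A (reesAlgebra Q) a *
        ⟨Polynomial.monomial k b, reesAlgebra.monomial_mem.2 hb⟩,
        Ideal.mul_mem_right _ _ (Ideal.mem_map_of_mem _ ha), ?_⟩
      exact Polynomial.C_mul_monomial
    · obtain ⟨u, hu, hua⟩ := ha
      obtain ⟨v, hv, hvb⟩ := hb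
      exact ⟨u + v, Ideal.add_mem _ hu hv, by simp [hua, hvb]⟩
  have hcoeff : ∀ k, (s : A[X]).coeff k ∈ IsLocalRing.maximalIdeal A * Q ^ k := by
    intro k
    have h1 : (s : A[X]).coeff k ∈ Ideal.span (x '' Set.univ) ^ k * (⊤ : Ideal A) := by
      rw [Set.image_univ, ← hQ, Ideal.mul_top]
      exact (mem_reesAlgebra_iff _ _).1 s.2 k
    obtain ⟨φ, hφ, hφs⟩ := exists_forms_eval_eq x h1
    have h2 : φ ∈ forms Set.univ (IsLocalRing.maximalIdeal A) k :=
      mem_forms_of_coeff_mem hφ fun m => (IsLocalRing.mem_maximalIdeal _).2 (hcon k φ hφ hφs m)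
    have h3 := eval_mem_of_mem_forms x h2
    rwa [hφs, Set.image_univ, ← hQ, mul_comm] at h3
  choose u hu hus using fun k => hmon k _ (hcoeff k)
  have hsum : s = ∑ k ∈ (s : A[X]).support, u k := by
    apply Subtype.ext
    rw [AddSubmonoidClass.coe_finsetSum]
    simp_rw [hus]
    exact (s : A[X]).as_sum_support
  rw [hsum]
  exact Ideal.sum_mem _ fun k _ => hu k

/-- If forms have independent coefficients for `J ^ 2` and `Q J`, no element outside `m R(Q)`
carries the class of `c t`, `c ∉ N`, into the submodule generated by the classes of `b t`,
`b ∈ N`. -/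
theorem mem_of_smul_mem_spanDegreeOne [IsLocalRing A] {σ : Type*} {x : σ → A}
    (hQ : Q = Ideal.span (Set.range x)) (hind : HasIndependentCoeffs x (J ^ 2) (Q * J))
    (hN : Q * J ≤ N) (hNJ : N ≤ J ^ 2) {c : A} (hc : c ∈ J ^ 2) {s : reesAlgebra Q}
    (hs : s ∉ (IsLocalRing.maximalIdeal A).map (algebraMap A (reesAlgebra Q)))
    (h : s • (mulRees J Q Q).mkQ (Polynomial.monomial 1 c) ∈ spanDegreeOne J Q N) : c ∈ N := by
  obtain ⟨k, φ, hφ, hφs, m, hm⟩ := exists_forms_isUnit_coeff hQ hs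
  rw [← map_smul] at h
  have h1 := coeff_mem_of_mkQ_mem_spanDegreeOne hN h k
  rw [Algebra.smul_def, Polynomial.coeff_mul_monomial] at h1
  have h1' : (s : A[X]).coeff k * c ∈ Ideal.span (x '' Set.univ) ^ k * N := by
    rw [Set.image_univ, ← hQ]
    exact h1
  obtain ⟨ψ, hψ, hψs⟩ := exists_forms_eval_eq x h1'
  have h2 : c • φ - ψ ∈ forms Set.univ (J ^ 2) k :=
    Submodule.sub_mem _ (by simpa using smul_mem_forms hc hφ) (forms_mono le_rfl hNJ hψ)
  have h3 := hind k _ h2 (by simp [hψs, hφs, MvPolynomial.smul_eval, mul_comm]) m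
  have h4 : c * φ.coeff m ∈ N := by simpa using Ideal.add_mem _ (hN h3.1) (hψ m).1
  exact (Ideal.mul_unit_mem_iff_mem N hm).1 h4

/-- A covering relation of ideals between `Q J` and `J ^ 2` gives a covering relation of submodules
of the Sally module localized at `m R(Q)`. -/
theorem localized_spanDegreeOne_covBy [IsLocalRing A] {σ : Type*} {x : σ → A}
    (hQ : Q = Ideal.span (Set.range x)) (hQJ : Q ≤ J)
    (hind : HasIndependentCoeffs x (J ^ 2) (Q * J))
    [hprime : ((IsLocalRing.maximalIdeal A).map (algebraMap A (reesAlgebra Q))).IsPrime]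
    (hN : Q * J ≤ N) (hN'J : N' ≤ J ^ 2) (hNN' : N ≤ N') {c : A} (hcN' : c ∈ N') (hcN : c ∉ N)
    (hdec : ∀ b ∈ N', ∃ r : A, b - r * c ∈ N)
    (hmc : ∀ r ∈ IsLocalRing.maximalIdeal A, r * c ∈ N) :
    ((spanDegreeOne J Q N).comap (sallyModule J Q).subtype).localized
        ((IsLocalRing.maximalIdeal A).map (algebraMap A (reesAlgebra Q))).primeCompl ⋖
      ((spanDegreeOne J Q N').comap (sallyModule J Q).subtype).localized
        ((IsLocalRing.maximalIdeal A).map (algebraMap A (reesAlgebra Q))).primeCompl := by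
  have hcS : (mulRees J Q Q).mkQ (Polynomial.monomial 1 c) ∈ sallyModule J Q :=
    Submodule.mem_map_of_mem ((monomial_mem_mulRees_self_iff hQJ).2 (hN'J hcN'))
  refine Submodule.localized_covBy _ (x := ⟨_, hcS⟩)
    (Submodule.comap_mono (spanDegreeOne_mono hNN'))
    (mkQ_monomial_mem_spanDegreeOne hcN') ?_ ?_ ?_
  · rintro ⟨z, hzS⟩ hz
    suffices h : ∀ z ∈ spanDegreeOne J Q N', ∃ t : reesAlgebra Q,
        z - t • (mulRees J Q Q).mkQ (Polynomial.monomial 1 c) ∈ spanDegreeOne J Q N from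
      h z hz
    intro z hz
    induction hz using Submodule.span_induction with
    | mem z hz =>
      obtain ⟨b, hb, rfl⟩ := hz
      obtain ⟨r, hr⟩ := hdec b hb
      refine ⟨algebraMap A _ r, ?_⟩
      have := mkQ_monomial_mem_spanDegreeOne (J := J) (Q := Q) hr
      rwa [map_sub, map_sub, ← algebraMap_smul_mkQ_monomial] at this
    | zero => exact ⟨0, by simp⟩
    | add y z _ _ hy hz =>
      obtain ⟨t, ht⟩ := hy
      obtain ⟨t', ht'⟩ := hz
      refine ⟨t + t', ?_⟩
      rw [add_smul, add_sub_add_comm]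
      exact Submodule.add_mem _ ht ht'
    | smul a z _ hz =>
      obtain ⟨t, ht⟩ := hz
      refine ⟨a * t, ?_⟩
      rw [mul_smul, ← smul_sub]
      exact Submodule.smul_mem _ a ht
  · suffices h : (IsLocalRing.maximalIdeal A).map (algebraMap A (reesAlgebra Q)) ≤
        Submodule.comap (LinearMap.toSpanSingleton (reesAlgebra Q) _
          ((mulRees J Q Q).mkQ (Polynomial.monomial 1 c))) (spanDegreeOne J Q N) from
      fun t ht => h ht
    rw [Ideal.map_le_iff_le_comap]
    intro r hr
    have := mkQ_monomial_mem_spanDegreeOne (J := J) (Q := Q) (hmc r hr)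
    rwa [← algebraMap_smul_mkQ_monomial] at this
  · intro s hs h
    exact hcN (mem_of_smul_mem_spanDegreeOne hQ hind hN (hNN'.trans hN'J) (hN'J hcN') hs h)

/-- The rank of a Sally module generated in degree one is the length of its component
`J ^ 2 / Q J` of degree one. -/
theorem sallyRank_eq_length [IsLocalRing A] {σ : Type*} {x : σ → A}
    (hQ : Q = Ideal.span (Set.range x)) (hQJ : Q ≤ J)
    (hind : HasIndependentCoeffs x (J ^ 2) (Q * J)) (hgen : SallyGeneratedInDegreeOne J Q)
    (hprime : ((IsLocalRing.maximalIdeal A).map (algebraMap A (reesAlgebra Q))).IsPrime)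
    (hfin : Module.length A (↥(J ^ 2) ⧸ Submodule.comap (J ^ 2).subtype (Q * J)) ≠ ⊤) :
    sallyRank J Q = Module.length A (↥(J ^ 2) ⧸ Submodule.comap (J ^ 2).subtype (Q * J)) := by
  classical
  rw [sallyRank, dif_pos hprime]
  set P := (IsLocalRing.maximalIdeal A).map (algebraMap A (reesAlgebra Q)) with hP
  set K := Submodule.comap (J ^ 2).subtype (Q * J) with hK
  have hQJ2 : Q * J ≤ J ^ 2 := by
    rw [pow_two]
    exact Ideal.mul_mono_left hQJ
  -- `W V` is the ideal between `Q J` and `J ^ 2` that corresponds to the submodule `V`.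
  let W : Submodule A (↥(J ^ 2) ⧸ K) → Ideal A := fun V => (V.comap K.mkQ).map (J ^ 2).subtype
  have hW : ∀ V c, c ∈ W V ↔ ∃ h : c ∈ J ^ 2, K.mkQ ⟨c, h⟩ ∈ V := by
    intro V c
    simp [W]
  have hWle : ∀ V, W V ≤ J ^ 2 := fun V c hc => ((hW V c).1 hc).1
  have hleW : ∀ V, Q * J ≤ W V := by
    intro V c hc
    refine (hW V c).2 ⟨hQJ2 hc, ?_⟩
    have h0 : K.mkQ ⟨c, hQJ2 hc⟩ = 0 :=
      (Submodule.Quotient.mk_eq_zero K).2 (show (⟨c, hQJ2 hc⟩ : ↥(J ^ 2)) ∈ K from hc)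
    rw [h0]
    exact V.zero_mem
  let F : Submodule A (↥(J ^ 2) ⧸ K) → Submodule (reesAlgebra Q) (sallyModule J Q) :=
    fun V => (spanDegreeOne J Q (W V)).comap (sallyModule J Q).subtype
  have hcov : ∀ {V V'}, V ⋖ V' → (F V).localized P.primeCompl ⋖ (F V').localized P.primeCompl := by
    intro V V' hVV'
    obtain ⟨v, hvV', hvV⟩ := Set.exists_of_ssubset hVV'.lt
    have hsup : ∀ w ∈ V', w ∉ V → V ⊔ Submodule.span A {w} = V' := by
      intro w hw hwV
      refine (hVV'.eq_or_eq le_sup_left (sup_le hVV'.le ?_)).resolve_left ?_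
      · simpa using hw
      · intro h
        exact hwV (h ▸ Submodule.mem_sup_right (Submodule.mem_span_singleton_self w))
    obtain ⟨⟨c, hc⟩, rfl⟩ := K.mkQ_surjective v
    have hcW' : c ∈ W V' := (hW _ _).2 ⟨hc, hvV'⟩
    have hcW : c ∉ W V := fun h => hvV ((hW _ _).1 h).2
    have hdec : ∀ b ∈ W V', ∃ r : A, b - r * c ∈ W V := by
      intro b hb
      obtain ⟨hbJ, hb⟩ := (hW _ _).1 hb
      rw [← hsup _ hvV' hvV] at hb
      obtain ⟨y, hy, z, hz, hyz⟩ := Submodule.mem_sup.1 hb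
      obtain ⟨r, rfl⟩ := Submodule.mem_span_singleton.1 hz
      refine ⟨r, (hW _ _).2 ⟨Ideal.sub_mem _ hbJ (Ideal.mul_mem_left _ r hc), ?_⟩⟩
      have : K.mkQ ⟨b - r * c, Ideal.sub_mem _ hbJ (Ideal.mul_mem_left _ r hc)⟩ =
          K.mkQ ⟨b, hbJ⟩ - r • K.mkQ ⟨c, hc⟩ := by
        rw [← map_smul, ← map_sub]
        rfl
      rw [this, ← hyz, add_sub_cancel_right]
      exact hy
    -- `V' / V` is simple, hence killed by the maximal ideal.
    have hmc : ∀ r ∈ IsLocalRing.maximalIdeal A, r * c ∈ W V := by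
      intro r hr
      by_contra hrc
      have hrJ : r * c ∈ J ^ 2 := Ideal.mul_mem_left _ r hc
      have hrV : K.mkQ ⟨r * c, hrJ⟩ ∉ V := fun h => hrc ((hW _ _).2 ⟨hrJ, h⟩)
      have hrsmul : K.mkQ ⟨r * c, hrJ⟩ = r • K.mkQ ⟨c, hc⟩ := by
        rw [← map_smul]
        rfl
      have h1 := hsup _ (hrsmul ▸ V'.smul_mem r hvV') hrV
      rw [← h1] at hvV'
      obtain ⟨y, hy, z, hz, hyz⟩ := Submodule.mem_sup.1 hvV'
      obtain ⟨t, rfl⟩ := Submodule.mem_span_singleton.1 hz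
      rw [hrsmul, smul_smul] at hyz
      have h2 : (1 - t * r) • K.mkQ ⟨c, hc⟩ ∈ V := by
        rw [sub_smul, one_smul]
        nth_rewrite 1 [← hyz]
        rwa [add_sub_cancel_right]
      have h3 : IsUnit (1 - t * r) := by
        have := IsLocalRing.isUnit_one_sub_self_of_mem_nonunits (t * r)
          (Ideal.mul_mem_left (IsLocalRing.maximalIdeal A) t hr)
        exact this
      exact hvV ((Submodule.smul_mem_iff_of_isUnit _ h3).1 h2)
    exact localized_spanDegreeOne_covBy hQ hQJ hind (hleW V) (hWle V')
      (Submodule.map_mono (Submodule.comap_mono hVV'.le)) hcW' hcW hdec hmc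
  have hbot : F ⊥ = ⊥ := by
    have h1 : W ⊥ = Q * J := by
      refine le_antisymm (fun c hc => ?_) (hleW _)
      obtain ⟨h, h2⟩ := (hW _ _).1 hc
      exact (Submodule.Quotient.mk_eq_zero K).1 h2
    simp only [F, h1, spanDegreeOne_mul]
    rw [Submodule.comap_bot, Submodule.ker_subtype]
  have htop : F ⊤ = ⊤ := by
    have h1 : W ⊤ = J ^ 2 := le_antisymm (hWle _) fun c hc => (hW _ _).2 ⟨hc, trivial⟩
    simp only [F, h1, ← hgen.sallyModule_eq hQJ]
    exact Submodule.comap_subtype_self _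
  refine length_eq_of_covBy_map (R' := Localization P.primeCompl)
    (M' := LocalizedModule P.primeCompl (sallyModule J Q))
    (fun V => (F V).localized P.primeCompl) (fun h => hcov h) ?_ ?_ hfin
  · change (F ⊥).localized P.primeCompl = ⊥
    rw [hbot, Submodule.localized, Submodule.localized'_bot]
  · change (F ⊤).localized P.primeCompl = ⊤
    rw [htop, Submodule.localized, Submodule.localized'_top]

end SallyRank

/-! ### Systems of parameters are quasi-regular -/

section Parameters

open IsLocalRing RingTheory.Sequence

/-- Weak regularity of a sequence on an ideal, in terms of elements. -/
theorem mem_of_mul_mem_of_isWeaklyRegular {A : Type*} [CommRing A] {M : Ideal A} {d : ℕ}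
    {x : Fin d → A} (h : IsWeaklyRegular M (List.ofFn x)) (i : Fin d) {z : A} (hz : z ∈ M)
    (hxz : x i * z ∈ Ideal.span (x '' {j | j < i}) * M) :
    z ∈ Ideal.span (x '' {j | j < i}) * M := by
  have h1 := h.regular_mod_prev i (by simp)
  rw [isSMulRegular_quotient_iff_mem_of_smul_mem] at h1
  have hlist : Ideal.ofList ((List.ofFn x).take i) = Ideal.span (x '' {j | j < i}) := by
    refine congrArg Ideal.span (Set.ext fun a => ?_)
    simp only [Set.mem_ofPred_eq, List.mem_take_iff_getElem, Set.mem_image]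
    constructor
    · rintro ⟨j, hj, rfl⟩
      have hj' : j < i.1 := (lt_min_iff.1 hj).1
      exact ⟨⟨j, hj'.trans i.2⟩, hj', by simp⟩
    · rintro ⟨j, hj, rfl⟩
      exact ⟨j.1, lt_min hj (by simp), by simp⟩
  have hmap : (Ideal.ofList ((List.ofFn x).take i) • (⊤ : Submodule A M)).map M.subtype =
      Ideal.span (x '' {j | j < i}) * M := by
    rw [Submodule.map_smul'', Submodule.map_top, Submodule.range_subtype, hlist, smul_eq_mul]
  have hiff : ∀ w : M, w ∈ Ideal.ofList ((List.ofFn x).take i) • (⊤ : Submodule A M) ↔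
      (w : A) ∈ Ideal.span (x '' {j | j < i}) * M := by
    intro w
    rw [← hmap]
    exact ⟨fun h => ⟨w, h, rfl⟩, fun ⟨w', h, hw⟩ => Subtype.ext hw ▸ h⟩
  exact (hiff ⟨z, hz⟩).1 (h1 ⟨z, hz⟩ ((hiff _).2 (by simpa using hxz)))

theorem isQuasiRegularOn_of_isWeaklyRegular {A : Type*} [CommRing A] {M : Ideal A} {d : ℕ}
    {x : Fin d → A} (h : IsWeaklyRegular M (List.ofFn x)) {i : ℕ} (hi : i ≤ d) :
    IsQuasiRegularOn x {j | j.1 < i} M := by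
  induction i with
  | zero => simpa using isQuasiRegularOn_empty
  | succ i ih =>
    have hset : {j : Fin d | j.1 < i + 1} = insert ⟨i, hi⟩ {j : Fin d | j.1 < i} := by
      ext j
      simp only [Set.mem_ofPred_eq, Set.mem_insert_iff, Fin.ext_iff]
      omega
    rw [hset]
    exact isQuasiRegularOn_insert (ih (by omega)) fun z hz hxz =>
      mem_of_mul_mem_of_isWeaklyRegular h ⟨i, hi⟩ hz hxz

theorem IsMaximalCohenMacaulay.isWeaklyRegular {A : Type u} [CommRing A] [IsLocalRing A]
    [IsNoetherianRing A] {M : Type u} [AddCommGroup M] [Module A M]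
    (hM : IsMaximalCohenMacaulay A M) {d : ℕ} {x : Fin d → A} (hx : IsSystemOfParameters x) :
    IsWeaklyRegular M (List.ofFn x) := by
  obtain ⟨hfin, rs, hrs, hreg, hdim⟩ := hM
  have : Nontrivial M := hreg.nontrivial
  have hlen : d = rs.length := by
    have := hx.1.symm.trans hdim
    exact_mod_cast this
  refine isWeaklyRegular_of_support rs _ (by simp [hlen]) hrs hreg.toIsWeaklyRegular ?_ ?_
  · intro r hr
    rw [← hx.2]
    obtain ⟨i, rfl⟩ := (List.mem_ofFn' _ _).1 hr
    exact Ideal.le_radical (Ideal.subset_span ⟨i, rfl⟩)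
  · intro p _ hp
    refine le_antisymm (le_maximalIdeal p.2.ne_top) ?_
    rw [← hx.2, p.2.radical_le_iff, Ideal.span_le]
    rintro _ ⟨i, rfl⟩
    exact hp _ ((List.mem_ofFn' _ _).2 ⟨i, rfl⟩)

theorem IsSystemOfParameters.comp_equiv {A : Type*} [CommRing A] [IsLocalRing A] {d : ℕ}
    {x : Fin d → A} (hx : IsSystemOfParameters x) (e : Fin d ≃ Fin d) :
    IsSystemOfParameters (x ∘ e) := by
  unfold IsSystemOfParameters
  rw [EquivLike.range_comp]
  exact hx

theorem IsSystemOfParameters.length_quotient_ne_top {A : Type*} [CommRing A] [IsLocalRing A]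
    [IsNoetherianRing A] {d : ℕ} {x : Fin d → A} (hx : IsSystemOfParameters x) :
    Module.length A (A ⧸ Ideal.span (Set.range x)) ≠ ⊤ := by
  set Q := Ideal.span (Set.range x) with hQ
  have : IsArtinianRing (A ⧸ Q) := by
    refine quotient_artinian_of_mem_minimalPrimes_of_isLocalRing Q ?_
    rw [← Ideal.radical_minimalPrimes, hx.2, Ideal.minimalPrimes_eq_subsingleton_self]
    rfl
  rw [Module.length_eq_of_surjective (R := A ⧸ Q) (S := A) Ideal.Quotient.mk_surjective]
  exact Module.length_ne_top

end Parameters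

/-! ### Hilbert functions -/

theorem Nat.sum_range_add_choose_self (e l : ℕ) :
    ∑ i ∈ Finset.range l, (i + e).choose e = (l + e).choose (e + 1) := by
  induction l with
  | zero => simp
  | succ l ih =>
    rw [Finset.sum_range_succ, ih, show l + 1 + e = l + e + 1 by ring, Nat.choose_succ_succ,
      Nat.add_comm]

section HilbertFunction

variable {A : Type*} [CommRing A] {e : ℕ} {x : Fin (e + 1) → A} {N N' : Ideal A}

theorem HasIndependentCoeffs.length_quotient_pow_mul (h : HasIndependentCoeffs x N N')
    (hN : N' ≤ N) (k : ℕ) :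
    Module.length A (A ⧸ Ideal.span (Set.range x) ^ k * N') =
      Module.length A (A ⧸ Ideal.span (Set.range x) ^ k * N) +
        (k + e).choose e * Module.length A (N ⧸ Submodule.comap N.subtype N') := by
  rw [length_quotient_eq_add (Ideal.mul_mono_right hN), length_pow_mul_quotient h,
    Fintype.card_fin, Nat.multichoose_eq, show e + 1 + k - 1 = k + e by omega,
    ← Nat.choose_symm_add]

theorem IsQuasiRegularOn.length_quotient_pow_mul (hq : IsQuasiRegularOn x Set.univ ⊤)
    (hN : Ideal.span (Set.range x) ≤ N) (k : ℕ) :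
    Module.length A (A ⧸ Ideal.span (Set.range x) ^ k * N) =
      Module.length A (A ⧸ Ideal.span (Set.range x) ^ k) +
        (k + e).choose e * Module.length A (A ⧸ N) := by
  have h := (hq.hasIndependentCoeffs (N' := N) (by simpa using hN) le_top).length_quotient_pow_mul
    le_top k
  have h0 := length_quotient_eq_add (le_top : N ≤ ⊤)
  have : Subsingleton (A ⧸ (⊤ : Ideal A)) := Ideal.Quotient.subsingleton_iff.2 rfl
  rw [Module.length_eq_zero (M := A ⧸ (⊤ : Ideal A)), zero_add] at h0
  rw [h, h0, Ideal.mul_top]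

theorem IsQuasiRegularOn.length_quotient_pow (hq : IsQuasiRegularOn x Set.univ ⊤) (k : ℕ) :
    Module.length A (A ⧸ Ideal.span (Set.range x) ^ k) =
      (k + e).choose (e + 1) * Module.length A (A ⧸ Ideal.span (Set.range x)) := by
  rw [← Nat.sum_range_add_choose_self]
  induction k with
  | zero => simp
  | succ k ih =>
    rw [pow_succ, hq.length_quotient_pow_mul le_rfl, ih, Finset.sum_range_succ, Nat.cast_add,
      add_mul]


/-- The Hilbert function of an ideal with a Sally module of rank `n` generated in degree one, in
additive form: both sides are `ℓ(A / Q ^ (k + 1) J)`, computed from `J ^ (k + 2) = Q ^ k J ^ 2` and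
from `A`. -/
theorem length_quotient_pow_add {J Q : Ideal A} (hQ : Q = Ideal.span (Set.range x)) (hQJ : Q ≤ J)
    (hq : IsQuasiRegularOn x Set.univ ⊤) (hind : HasIndependentCoeffs x (J ^ 2) (Q * J))
    (hpow : ∀ k, J ^ (k + 2) = Q ^ k * J ^ 2) (k : ℕ) :
    Module.length A (A ⧸ J ^ (k + 2)) + (k + e).choose e *
        Module.length A (↥(J ^ 2) ⧸ Submodule.comap (J ^ 2).subtype (Q * J)) =
      (k + 1 + e).choose (e + 1) * Module.length A (A ⧸ Q) +
        (k + 1 + e).choose e * Module.length A (A ⧸ J) := by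
  have hQJ2 : Q * J ≤ J ^ 2 := by
    rw [pow_two]
    exact Ideal.mul_mono_left hQJ
  have h1 := hind.length_quotient_pow_mul hQJ2 k
  have h2 := hq.length_quotient_pow_mul (hQ ▸ hQJ) (k + 1)
  rw [hq.length_quotient_pow, ← hQ] at h2
  rw [← hQ, ← mul_assoc, ← pow_succ, ← hpow, h2] at h1
  exact h1.symm

end HilbertFunction

theorem IsSystemOfParameters.isQuasiRegularOn_top {A : Type u} [CommRing A] [IsLocalRing A]
    (hA : IsCohenMacaulayLocalRing A) {d : ℕ} {x : Fin d → A}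
    (hx : IsSystemOfParameters x) : IsQuasiRegularOn x Set.univ (⊤ : Ideal A) := by
  have := hA.1
  have h := isQuasiRegularOn_of_isWeaklyRegular (M := (⊤ : Ideal A))
    (((Submodule.topEquiv (R := A) (M := A)).isWeaklyRegular_congr _).2
      (hA.2.isWeaklyRegular hx)) le_rfl
  rwa [show {j : Fin d | j.1 < d} = Set.univ from Set.eq_univ_of_forall fun j => j.2] at h

/-- A maximal Cohen-Macaulay ideal `I` and a parameter ideal `Q` with one generator in `I` satisfy
the hypotheses of `hasIndependentCoeffs_sq_mul`. -/
theorem IsSystemOfParameters.hasIndependentCoeffs {A : Type u} [CommRing A] [IsLocalRing A]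
    [IsNoetherianRing A] {I : Ideal A} (hI : IsMaximalCohenMacaulay A I) {e : ℕ}
    {x : Fin (e + 1) → A} (hx : IsSystemOfParameters x) (hlast : x (Fin.last e) ∈ I) :
    HasIndependentCoeffs x ((I ⊔ Ideal.span (Set.range x)) ^ 2)
      (Ideal.span (Set.range x) * (I ⊔ Ideal.span (Set.range x))) := by
  have hreg := hI.isWeaklyRegular hx
  have h1 : ({Fin.last e}ᶜ : Set (Fin (e + 1))) = {j | j.1 < e} := by
    ext j
    exact Fin.lt_last_iff_ne_last.symm
  have h2 : ({Fin.last e}ᶜ : Set (Fin (e + 1))) = {j | j < Fin.last e} := by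
    ext j
    exact Fin.lt_last_iff_ne_last.symm
  refine hasIndependentCoeffs_sq_mul hlast ?_ ?_ rfl
  · rw [h1]
    exact isQuasiRegularOn_of_isWeaklyRegular hreg (by omega)
  · intro z hz hxz
    rw [h2] at hxz ⊢
    exact mem_of_mul_mem_of_isWeaklyRegular hreg _ hz hxz

/-! ### Hilbert coefficients and the theorem -/

theorem IsHilbertCoefficients.of_sally_one {A : Type*} [CommRing A] {J : Ideal A} {q c n : ℤ}
    (h : ∀ k, (hilbertFunction J (k + 1) : ℤ) + n = (k + 1) * q + c) :
    IsHilbertCoefficients 1 J fun i => if i = 0 then q else if i = 1 then q - c + n else 0 := by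
  refine ⟨fun i hi => by simp [show i ≠ 0 by omega, show i ≠ 1 by omega], ?_⟩
  refine eventually_atTop.2 ⟨1, fun l hl => ?_⟩
  obtain ⟨k, rfl⟩ : ∃ k, l = k + 1 := ⟨l - 1, by omega⟩
  rw [eq_sub_of_add_eq (h k)]
  simp [Finset.sum_range_succ]
  ring

theorem IsHilbertCoefficients.of_sally {A : Type*} [CommRing A] {J : Ideal A} {q c n : ℤ} {f : ℕ}
    (h : ∀ᶠ l in atTop, (hilbertFunction J l : ℤ) = q * ((l + (f + 2)).choose (f + 2) : ℤ) -
      (q - c + n) * ((l + (f + 1)).choose (f + 1) : ℤ) + n * ((l + f).choose f : ℤ)) :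
    IsHilbertCoefficients (f + 2) J fun i =>
      if i = 0 then q else if i = 1 then q - c + n else if i = 2 then n else 0 := by
  refine ⟨fun i hi => by
    simp [show i ≠ 0 by omega, show i ≠ 1 by omega, show i ≠ 2 by omega], ?_⟩
  filter_upwards [h] with l hl
  rw [hl, Finset.sum_range_succ', Finset.sum_range_succ', Finset.sum_range_succ',
    Finset.sum_eq_zero]
  · simp
    ring
  · intro i _
    simp

/-- In dimension at least two, the formula for the Hilbert function holds from `l = 0` on, by two
applications of Pascal's rule. -/
theorem hilbertFunction_eq_of_add_eq {A : Type*} [CommRing A] {J : Ideal A} {q c n : ℤ} {f : ℕ}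
    (h0 : (hilbertFunction J 0 : ℤ) = c)
    (h : ∀ k : ℕ, (hilbertFunction J (k + 1) : ℤ) + ((k + (f + 1)).choose (f + 1) : ℤ) * n =
      ((k + 1 + (f + 1)).choose (f + 2) : ℤ) * q + ((k + 1 + (f + 1)).choose (f + 1) : ℤ) * c)
    (l : ℕ) :
    (hilbertFunction J l : ℤ) = q * ((l + (f + 2)).choose (f + 2) : ℤ) -
      (q - c + n) * ((l + (f + 1)).choose (f + 1) : ℤ) + n * ((l + f).choose f : ℤ) := by
  rcases l with _ | k
  · simp [h0]
    ring
  · rw [eq_sub_of_add_eq (h k)]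
    have h1 : (k + 1 + (f + 2)).choose (f + 2) =
        (k + 1 + (f + 1)).choose (f + 1) + (k + 1 + (f + 1)).choose (f + 2) :=
      Nat.choose_succ_succ _ _
    have h2 : (k + 1 + (f + 1)).choose (f + 1) =
        (k + 1 + f).choose f + (k + 1 + f).choose (f + 1) :=
      Nat.choose_succ_succ _ _
    rw [show k + (f + 1) = k + 1 + f by ring, h1, h2]
    push_cast
    ring

theorem corollary10 {A : Type u} [CommRing A] [IsLocalRing A]
    (hA : IsCohenMacaulayLocalRing A) (d : ℕ) (hd : ringKrullDim A = d) (hdpos : 0 < d)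
    (I : Ideal A) (hI : IsCanonicalIdeal I)
    (n : ℕ) (hn : 1 ≤ n) (Q : Ideal A) (hQ : SatisfiesSharp I Q)
    (J : Ideal A) (hJ : J = I ⊔ Q) (hG : IsGotoWithRespectTo n I Q) :
    (∀ l : ℕ, Module.length A (A ⧸ J ^ (l + 1)) ≠ ⊤) ∧
    (2 ≤ d → ∀ l : ℕ, (hilbertFunction J l : ℤ) =
      hilbertCoeff d J 0 * ((l + d).choose d : ℤ)
        - (hilbertCoeff d J 0 - ((Module.length A (A ⧸ J)).toNat : ℤ) + n)
            * ((l + d - 1).choose (d - 1) : ℤ)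
        + n * ((l + d - 2).choose (d - 2) : ℤ)) ∧
    (d = 1 → ∀ l : ℕ, 1 ≤ l → (hilbertFunction J l : ℤ) =
      hilbertCoeff d J 0 * ((l + 1 : ℕ) : ℤ)
        - (hilbertCoeff d J 0 - ((Module.length A (A ⧸ J)).toNat : ℤ) + n)) ∧
    (2 ≤ d → hilbertCoeff d J 2 = n) ∧
    (∀ i : ℕ, 3 ≤ i → i ≤ d → hilbertCoeff d J i = 0) := by
  have hnoeth := hA.1
  obtain ⟨d', hd', a, ha, hQa, ha0⟩ := hQ.1
  obtain rfl : d' = d := by exact_mod_cast ha.1.symm.trans hd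
  obtain ⟨e, rfl⟩ : ∃ e, d' = e + 1 := ⟨d' - 1, by omega⟩
  -- The order of the parameters is reversed, so that the one in `I` comes last.
  set x : Fin (e + 1) → A := a ∘ Fin.revPerm with hxdef
  have hx : IsSystemOfParameters x := ha.comp_equiv Fin.revPerm
  have hlast : x (Fin.last e) ∈ I := by
    rw [hxdef, Function.comp_apply, Fin.revPerm_apply, Fin.rev_last]
    exact ha0
  have hQx : Q = Ideal.span (Set.range x) := by
    rw [hQa, hxdef, EquivLike.range_comp]
  have hQJ : Q ≤ J := hJ ▸ le_sup_right
  obtain ⟨-, hgen, hrank⟩ := hG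
  rw [← hJ] at hgen hrank
  have hq := hx.isQuasiRegularOn_top hA
  have hind : HasIndependentCoeffs x (J ^ 2) (Q * J) := by
    rw [hJ, hQx]
    exact hx.hasIndependentCoeffs hI.2.1 hlast
  have hQfin : Module.length A (A ⧸ Q) ≠ ⊤ := hQx ▸ hx.length_quotient_ne_top
  have hJfin : Module.length A (A ⧸ J) ≠ ⊤ := fun h => hQfin <| top_le_iff.1 <| h ▸
    Module.length_le_of_surjective (Submodule.factor hQJ) (Submodule.factor_surjective hQJ)
  have hlen := length_quotient_pow_add hQx hQJ hq hind (hgen.pow_eq hQJ)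
  set v := Module.length A (↥(J ^ 2) ⧸ Submodule.comap (J ^ 2).subtype (Q * J)) with hv
  obtain ⟨q, hqe⟩ := ENat.ne_top_iff_exists.1 hQfin
  obtain ⟨c, hce⟩ := ENat.ne_top_iff_exists.1 hJfin
  rw [← hqe, ← hce] at hlen
  have hvfin : v ≠ ⊤ := by
    intro h
    have h0 := hlen 0
    rw [h] at h0
    simp only [Nat.zero_add, Nat.choose_self, Nat.cast_one, one_mul, add_top] at h0
    exact absurd h0.symm (by exact_mod_cast ENat.natCast_ne_top _)
  -- The rank is positive, so the ideal `m R(Q)` at which it is computed is prime.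
  have hprime : ((IsLocalRing.maximalIdeal A).map (algebraMap A (reesAlgebra Q))).IsPrime := by
    by_contra h
    rw [sallyRank, dif_neg h] at hrank
    have : n = 0 := by exact_mod_cast hrank.symm
    omega
  have hvn : v = n := (sallyRank_eq_length hQx hQJ hind hgen hprime hvfin).symm.trans hrank
  rw [hvn] at hlen
  have hfin : ∀ l : ℕ, Module.length A (A ⧸ J ^ (l + 1)) ≠ ⊤ := by
    intro l h
    rcases l with _ | k
    · rw [zero_add, pow_one] at h
      exact hJfin h
    · have h0 := hlen k
      rw [h, top_add] at h0
      exact absurd h0.symm (by exact_mod_cast ENat.natCast_ne_top _)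
  have hc : (Module.length A (A ⧸ J)).toNat = c := by rw [← hce, ENat.toNat_natCast]
  have hH0 : (hilbertFunction J 0 : ℤ) = c := by
    rw [hilbertFunction, zero_add, pow_one, hc]
  have hH : ∀ k : ℕ, (hilbertFunction J (k + 1) : ℤ) + ((k + e).choose e : ℤ) * n =
      ((k + 1 + e).choose (e + 1) : ℤ) * q + ((k + 1 + e).choose e : ℤ) * c := by
    intro k
    have h0 := hlen k
    rw [← ENat.natCast_toNat (hfin (k + 1))] at h0
    exact_mod_cast h0
  refine ⟨hfin, ?_⟩
  rw [hc]
  rcases e with _ | f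
  · have hcoef := IsHilbertCoefficients.of_sally_one (J := J) (q := q) (c := c) (n := n)
      fun k => by simpa using hH k
    refine ⟨by omega, fun _ l hl => ?_, by omega, by omega⟩
    obtain ⟨k, rfl⟩ : ∃ k, l = k + 1 := ⟨l - 1, by omega⟩
    have := hH k
    simp only [zero_add, hcoef.hilbertCoeff_eq, if_true]
    simp at this
    push_cast
    linarith
  · have hHl := hilbertFunction_eq_of_add_eq hH0 hH
    have hcoef := IsHilbertCoefficients.of_sally (Eventually.of_forall hHl)
    simp only [show f + 1 + 1 = f + 2 from rfl, hcoef.hilbertCoeff_eq]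
    refine ⟨fun _ l => ?_, by omega, fun _ => by simp, fun i hi _ => ?_⟩
    · rw [show l + (f + 2) - 2 = l + f by omega]
      simpa using hHl l
    · simp [show i ≠ 0 by omega, show i ≠ 1 by omega, show i ≠ 2 by omega]
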